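/- Conventions. A representation of a set $X$ is a surjective partial map $\delta_X:\subseteq\mathbb N^{\mathbb N}\to X$. A problem $f:\subseteq X\rightrightarrows Y$ is a partial multivalued map between represented spaces, with $\operatorname{dom}(f)=\{x: f(x)\neq\emptyset\}$; a partial function $F:\subseteq\mathbb N^{\mathbb N}\to\mathbb N^{\mathbb N}$ is a realizer of $f$, written $F\vdash f$, if $\delta_YF(p)\in f(\delta_X(p))$ for all $p\in\operatorname{dom}(f\delta_X)$. Composition of multivalued maps is $g\circ f(x)=\bigcup_{y\in f(x)}g(y)$ with $\operatorname{dom}(g\circ f)=\{x\in\operatorname{dom}(f): f(x)\subseteq\operatorname{dom}(g)\}$. The realizer version of $f$ is $f^{\mathrm r}:=\delta_Y^{-1}\circ f\circ\delta_X$. A partial function $F$ on $\mathbb N^{\mathbb N}$ is computable if there is a computable prefix-monotone word function $h$ with $F(p)=\sup_{w\sqsubseteq p}h(w)$ for all $p\in\operatorname{dom}(F)$. Let $\langle q,p\rangle=q(0)p(0)q(1)p(1)\dots$, let $\langle q_0,q_1,\dots\rangle$ be the infinite tupling $\langle q_0,q_1,\dots\rangle(\langle n,k\rangle)=q_n(k)$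 for a standard pairing of $\mathbb N$, and let $\mathsf U\langle q,p\rangle=\Phi_q(p)$ be the universal function, where $q$ is read as a list of (codes of) pairs of words in which the digits $0,1,2$ are dummy symbols, and $\Phi_q(p)$ is the supremum of all words $w$ such that $(v,w)$ is listed in $q$ for some prefix $v$ of $p$, if this supremum exists in $\mathbb N^{\mathbb N}$ (undefined otherwise). Further, $\langle \mathrm{id}\times f\rangle\langle p,q\rangle=\{\langle p,r\rangle:r\in f(q)\}$. We write $f\leq_{\mathrm W}g$ (respectively $f\leq_{\mathrm{sW}}g$) if there are computable $H,K:\subseteq\mathbb N^{\mathbb N}\to\mathbb N^{\mathbb N}$ such that $H\langle\mathrm{id},GK\rangle\vdash f$ (respectively $HGK\vdash f$) for every $G\vdash g$, and $\equiv_{\mathrm{sW}}$ for the equivalence induced by $\leq_{\mathrm{sW}}$. A problem $f$ is pointed if $\mathrm{id}\leq_{\mathrm W}f$ for the identity $\mathrm{id}$ of $\mathbb N^{\mathbb N}$. The parallelization $\widehat f:\subseteq X^{\mathbb N}\rightrightarrows Y^{\mathbb N}$ is $\widehat f((x_i)_i)=\prod_i f(x_i)$, where $\langle p_0,p_1,\dots\rangle$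 is a name of $(x_i)_i$ if each $p_i$ is a name of $x_i$. For $f:\subseteq\mathbb N^{\mathbb N}\rightrightarrows\mathbb N^{\mathbb N}$ put $S:=\mathsf U\circ\langle\mathrm{id}\times f\rangle$. A finite run is $q_0,\dots,q_k$ with $q_{i+1}\in S(q_i)$ for all $i<k$; an infinite run is $q_0,q_1,\dots$ with $q_{i+1}\in S(q_i)$ for all $i$. A finite run is successful if $q_k(0)=0$ and $q_i(0)\neq0$ for all $i<k$; it stalls if $q_k\notin\operatorname{dom}(S)$ and $q_i(0)\neq0$ for all $i\leq k$; an infinite run is unsuccessful if $q_i(0)\neq0$ for all $i$. The inverse limit is $$f^\infty(q_0)=\{\langle q_0,q_1,q_2,\dots\rangle : q_0,q_1,q_2,\dots\text{ is an infinite run}\},$$ where $\operatorname{dom}(f^\infty)$ consists of all $q_0$ such that $A_i\subseteq\operatorname{dom}(S)$ for all $i$, where $A_0=\{q_0\}$ and $A_{i+1}=S(A_i)$. The diamond is $$f^\diamond(q_0)=\{q_k : q_0,\dots,q_k\text{ is a successful finite run for some }k\text{ and some }q_1,\dots,q_k\},$$ where $\operatorname{dom}(f^\diamond)$ consists of all $q_0$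 such that no run starting with $q_0$ stalls or is infinite and unsuccessful. For arbitrary problems $f$ let $f^\infty:=(f^{\mathrm r})^\infty$ and $f^\diamond:=(f^{\mathrm r})^\diamond$. Proposition. For every problem $f:\subseteq X\rightrightarrows Y$ on represented spaces: (1) $\widehat{f^\infty}\equiv_{\mathrm{sW}}f^\infty$; (2) if $f$ is pointed, then $f^\diamond\leq_{\mathrm{sW}}f^\infty$; (3) if $f$ is pointed, then $\widehat{f^\diamond}\leq_{\mathrm{sW}}f^\infty$. -/

import Mathlib

namespace Weihrauch

universe u v w z

/-- Baire space `ℕ^ℕ`. -/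
abbrev Baire : Type := ℕ → ℕ

/-! ### Words, tuples and computable functions on Baire space -/

/-- The prefix of length `n` of `p`. -/
def word (p : Baire) (n : ℕ) : List ℕ := (List.range n).map p

/-- `r` is the supremum, in the prefix order, of the words in the set `S`. -/
def IsSupWords (S : Set (List ℕ)) (r : Baire) : Prop :=
  (∀ w ∈ S, ∃ m, w = word r m) ∧ ∀ m, ∃ w ∈ S, word r m <+: w

/-- Monotonicity of a word function with respect to the prefix order. -/
def MonotoneWord (h : List ℕ → List ℕ) : Prop := ∀ v w, v <+: w → h v <+: h w

/-- The word function `h` approximates the partial function `F`. -/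
def Approximates (h : List ℕ → List ℕ) (F : Baire →. Baire) : Prop :=
  ∀ p r, r ∈ F p → IsSupWords {w | ∃ n, w = h (word p n)} r

/-- Computability of a partial function on Baire space. -/
def IsComputable (F : Baire →. Baire) : Prop :=
  ∃ h : List ℕ → List ℕ, Computable h ∧ MonotoneWord h ∧ Approximates h F

/-- The pairing `⟨q,p⟩ = q(0) p(0) q(1) p(1) ...`. -/
def pair (q p : Baire) : Baire := fun n => if n % 2 = 0 then q (n / 2) else p (n / 2)

/-- First component of a pair. -/
def fstB (s : Baire) : Baire := fun n => s (2 * n)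

/-- Second component of a pair. -/
def sndB (s : Baire) : Baire := fun n => s (2 * n + 1)

/-- The infinite tupling `⟨p₀,p₁,p₂,...⟩`. -/
def tuple (p : ℕ → Baire) : Baire := fun m => p m.unpair.1 m.unpair.2

/-- The `i`-th component of an infinite tuple. -/
def proj (i : ℕ) (s : Baire) : Baire := fun k => s (Nat.pair i k)

theorem proj_tuple (p : ℕ → Baire) (i : ℕ) : proj i (tuple p) = p i := by
  funext k; simp [proj, tuple]

theorem fstB_pair (q p : Baire) : fstB (pair q p) = q := by
  funext n; simp [fstB, pair]

theorem sndB_pair (q p : Baire) : sndB (pair q p) = p := by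
  funext n
  have h : (2 * n + 1) / 2 = n := by omega
  simp [sndB, pair, h]

theorem pair_surj (s : Baire) : pair (fstB s) (sndB s) = s := by
  funext n
  unfold pair fstB sndB
  split_ifs with h <;> congr 1 <;> omega

/-! ### The universal function -/

/-- The pair of words `(v,w)` is listed in `q`. The digits `0,1,2` of `q` are dummy symbols. -/
def Lists (q : Baire) (v w : List ℕ) : Prop := ∃ i, q i = Encodable.encode (v, w) + 3

/-- The words that the list `q` assigns to the prefixes of `p`. -/
def listed (q p : Baire) : Set (List ℕ) := {w | ∃ n, Lists q (word p n) w}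

theorem word_length (p : Baire) (n : ℕ) : (word p n).length = n := by simp [word]

theorem word_getElem (p : Baire) (n k : ℕ) (hk : k < (word p n).length) :
    (word p n)[k] = p k := by simp [word]

theorem IsSupWords.unique {S : Set (List ℕ)} {r s : Baire}
    (hr : IsSupWords S r) (hs : IsSupWords S s) : r = s := by
  funext k
  obtain ⟨w, hw, hpre⟩ := hr.2 (k + 1)
  obtain ⟨m, rfl⟩ := hs.1 w hw
  have hk : k < (word r (k + 1)).length := by rw [word_length]; omega
  have h := hpre.getElem hk
  rwa [word_getElem, word_getElem] at h

open Classical in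
/-- The function `Φ_q` named by `q`: its value at `p` is the supremum of the words that `q` assigns
to the prefixes of `p`, and it is undefined where this supremum does not exist in Baire space. If
`q` lists the graph of a monotone word function `h`, then `Φ_q(p)` is the supremum of the words
`h(w)` for prefixes `w` of `p`. -/
noncomputable def Phi (q : Baire) : Baire →. Baire := fun p =>
  ⟨∃ r, IsSupWords (listed q p) r, fun h => h.choose⟩

theorem mem_Phi {q p r : Baire} : r ∈ Phi q p ↔ IsSupWords (listed q p) r := by
  constructor
  · rintro ⟨h, rfl⟩
    exact h.choose_spec
  · intro h
    have hd : ∃ r, IsSupWords (listed q p) r := ⟨r, h⟩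
    exact ⟨hd, hd.choose_spec.unique h⟩

/-- The universal function `U⟨q,p⟩ = Φ_q(p)`. -/
noncomputable def universal : Baire →. Baire := fun s => Phi (fstB s) (sndB s)

/-! ### Multivalued maps, represented spaces and problems -/

/-- Partial multivalued maps; the domain is the set of points with a nonempty value. -/
abbrev MultiMap (X : Type u) (Y : Type v) : Type (max u v) := X → Set Y

/-- The domain of a partial multivalued map. -/
def mdom {X : Type u} {Y : Type v} (f : MultiMap X Y) : Set X := {x | (f x).Nonempty}

/-- A partial function as a partial multivalued map. -/
def ofPFun {X : Type u} {Y : Type v} (F : X →. Y) : MultiMap X Y := fun x => {y | y ∈ F x}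

/-- The composition `g ∘ f`, with domain `{x ∈ dom f | f(x) ⊆ dom g}`. -/
def mcomp {X : Type u} {Y : Type v} {Z : Type w} (g : MultiMap Y Z) (f : MultiMap X Y) :
    MultiMap X Z := fun x => {c | f x ⊆ mdom g ∧ ∃ y ∈ f x, c ∈ g y}

/-- A representation of `X`: a surjective partial map from Baire space to `X`. -/
structure Representation (X : Type u) where
  /-- the partial map -/
  map : Baire →. X
  surj : ∀ x, ∃ p, x ∈ map p

/-- Baire space is represented by the identity. -/
def Representation.baire : Representation Baire where
  map := fun p => Part.some p
  surj := fun p => ⟨p, Part.mem_some p⟩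

/-- The representation of sequences: `⟨p₀,p₁,...⟩` is a name of `(x₀,x₁,...)` if every `pᵢ` is
a name of `xᵢ`. -/
def Representation.seq {X : Type u} (δ : Representation X) : Representation (ℕ → X) where
  map := fun p => ⟨∀ i, (δ.map (proj i p)).Dom, fun h i => (δ.map (proj i p)).get (h i)⟩
  surj := fun x => by
    choose p hp using fun i => δ.surj (x i)
    have hp2 : ∀ i, x i ∈ δ.map (proj i (tuple p)) := fun i => by
      rw [proj_tuple]; exact hp i
    exact ⟨tuple p, fun i => Part.dom_iff_mem.2 ⟨_, hp2 i⟩,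
      funext fun i => Part.get_eq_of_mem (hp2 i) _⟩

/-- A problem: a partial multivalued map between represented spaces. It always has a realizer,
see `Problem.exists_realizer`. -/
structure Problem (X : Type u) (Y : Type v) where
  /-- representation of the space of instances -/
  inRep : Representation X
  /-- representation of the space of solutions -/
  outRep : Representation Y
  /-- the multivalued map -/
  map : MultiMap X Y

/-- `F` is a realizer of `f`. -/
def Realizes {X : Type u} {Y : Type v} (F : Baire →. Baire) (f : Problem X Y) : Prop :=
  ∀ p, ∀ x ∈ f.inRep.map p, x ∈ mdom f.map →
    ∃ r ∈ F p, ∃ y ∈ f.outRep.map r, y ∈ f.map x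

theorem Problem.exists_realizer {X : Type u} {Y : Type v} (f : Problem X Y) :
    ∃ F, Realizes F f := by
  classical
  have H : ∀ p, ∃ r, ∀ x ∈ f.inRep.map p, x ∈ mdom f.map →
      ∃ y ∈ f.outRep.map r, y ∈ f.map x := by
    intro p
    by_cases h : ∃ x ∈ f.inRep.map p, x ∈ mdom f.map
    · obtain ⟨x, hx, y, hy⟩ := h
      obtain ⟨r, hr⟩ := f.outRep.surj y
      exact ⟨r, fun x2 hx2 _ => ⟨y, hr, Part.mem_unique hx hx2 ▸ hy⟩⟩
    · exact ⟨p, fun x hx hd => absurd ⟨x, hx, hd⟩ h⟩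
  choose F hF using H
  exact ⟨fun p => Part.some (F p), fun p x hx hd => ⟨F p, Part.mem_some _, hF p x hx hd⟩⟩

/-- A multivalued map on Baire space as a problem. -/
def Problem.onBaire (f : MultiMap Baire Baire) : Problem Baire Baire where
  inRep := Representation.baire
  outRep := Representation.baire
  map := f

/-- The identity of Baire space. -/
def idProblem : Problem Baire Baire := Problem.onBaire fun p => {p}

/-- The realizer version `δ_Y⁻¹ ∘ f ∘ δ_X` of a problem. -/
def Problem.realizerVersion {X : Type u} {Y : Type v} (f : Problem X Y) : MultiMap Baire Baire :=
  mcomp (fun y => {r | y ∈ f.outRep.map r}) (mcomp f.map (ofPFun f.inRep.map))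

/-- The parallelization `(xᵢ)ᵢ ↦ ∏ᵢ f(xᵢ)`. -/
def Problem.parallelization {X : Type u} {Y : Type v} (f : Problem X Y) :
    Problem (ℕ → X) (ℕ → Y) where
  inRep := f.inRep.seq
  outRep := f.outRep.seq
  map := fun x => {y | ∀ i, y i ∈ f.map (x i)}

/-! ### Weihrauch reducibility -/

/-- Weihrauch reducibility. -/
def WReducible {X : Type u} {Y : Type v} {Z : Type w} {W : Type z}
    (f : Problem X Y) (g : Problem Z W) : Prop :=
  ∃ H K : Baire →. Baire, IsComputable H ∧ IsComputable K ∧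
    ∀ G : Baire →. Baire, Realizes G g →
      Realizes (fun p => ((K p).bind G).bind fun r => H (pair p r)) f

/-- Strong Weihrauch reducibility. -/
def SWReducible {X : Type u} {Y : Type v} {Z : Type w} {W : Type z}
    (f : Problem X Y) (g : Problem Z W) : Prop :=
  ∃ H K : Baire →. Baire, IsComputable H ∧ IsComputable K ∧
    ∀ G : Baire →. Baire, Realizes G g → Realizes (fun p => ((K p).bind G).bind H) f

/-- Strong Weihrauch equivalence. -/
def SWEquiv {X : Type u} {Y : Type v} {Z : Type w} {W : Type z}
    (f : Problem X Y) (g : Problem Z W) : Prop := SWReducible f g ∧ SWReducible g f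

/-- A problem is pointed if the identity of Baire space is Weihrauch reducible to it. -/
def Problem.Pointed {X : Type u} {Y : Type v} (f : Problem X Y) : Prop := WReducible idProblem f

/-! ### Inverse limit and diamond -/

/-- The map `⟨id × f⟩`, that is `⟨p,q⟩ ↦ {⟨p,r⟩ | r ∈ f(q)}`. -/
def idProd (f : MultiMap Baire Baire) : MultiMap Baire Baire :=
  fun s => {t | ∃ r ∈ f (sndB s), t = pair (fstB s) r}

/-- One pass of the loop on `f`: the map `U ∘ ⟨id × f⟩`. -/
noncomputable def step (f : MultiMap Baire Baire) : MultiMap Baire Baire :=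
  mcomp (ofPFun universal) (idProd f)

/-- The sets `A₀ = {q₀}`, `Aᵢ₊₁ = (U ∘ ⟨id × f⟩)(Aᵢ)`. -/
noncomputable def reach (f : MultiMap Baire Baire) (q0 : Baire) : ℕ → Set Baire
  | 0 => {q0}
  | i + 1 => {r | ∃ q ∈ reach f q0 i, r ∈ step f q}

/-- The domain of the inverse limit of `f`. -/
def invLimDom (f : MultiMap Baire Baire) : Set Baire :=
  {q0 | ∀ i, reach f q0 i ⊆ mdom (step f)}

/-- `q₀,q₁,q₂,...` is an infinite run on `f`. -/
def IsInfiniteRun (f : MultiMap Baire Baire) (q : ℕ → Baire) : Prop :=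
  ∀ i, q (i + 1) ∈ step f (q i)

/-- `q₀,...,q_k` is a finite run on `f`; the later terms of the sequence are irrelevant. -/
def IsFiniteRun (f : MultiMap Baire Baire) (k : ℕ) (q : ℕ → Baire) : Prop :=
  ∀ i < k, q (i + 1) ∈ step f (q i)

/-- The inverse limit of a multivalued map on Baire space. -/
def invLim (f : MultiMap Baire Baire) : MultiMap Baire Baire :=
  fun q0 => {s | q0 ∈ invLimDom f ∧ ∃ q, q 0 = q0 ∧ IsInfiniteRun f q ∧ s = tuple q}

/-- The finite run `q₀,...,q_k` is successful. -/
def Successful (k : ℕ) (q : ℕ → Baire) : Prop := q k 0 = 0 ∧ ∀ i < k, q i 0 ≠ 0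

/-- The infinite run `q₀,q₁,...` is unsuccessful. -/
def Unsuccessful (q : ℕ → Baire) : Prop := ∀ i, q i 0 ≠ 0

/-- The finite run `q₀,...,q_k` stalls. -/
def Stalls (f : MultiMap Baire Baire) (k : ℕ) (q : ℕ → Baire) : Prop :=
  q k ∉ mdom (step f) ∧ ∀ i ≤ k, q i 0 ≠ 0

/-- The domain of the diamond of `f`. -/
def diamondDom (f : MultiMap Baire Baire) : Set Baire :=
  {q0 | (¬ ∃ k q, q 0 = q0 ∧ IsFiniteRun f k q ∧ Stalls f k q) ∧
    ¬ ∃ q, q 0 = q0 ∧ IsInfiniteRun f q ∧ Unsuccessful q}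

/-- The diamond of a multivalued map on Baire space. -/
def diamondMap (f : MultiMap Baire Baire) : MultiMap Baire Baire :=
  fun q0 => {s | q0 ∈ diamondDom f ∧
    ∃ k q, q 0 = q0 ∧ IsFiniteRun f k q ∧ Successful k q ∧ s = q k}

theorem mdom_invLim (f : MultiMap Baire Baire) : mdom (invLim f) = invLimDom f := by
  classical
  ext q0
  constructor
  · rintro ⟨s, h, _⟩
    exact h
  · intro h
    have hs : ∀ q, ∃ r, q ∈ mdom (step f) → r ∈ step f q := fun q => by
      by_cases hq : q ∈ mdom (step f)
      · exact ⟨hq.choose, fun _ => hq.choose_spec⟩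
      · exact ⟨q, fun h => absurd h hq⟩
    choose n hn using hs
    have hr : ∀ i, n^[i] q0 ∈ reach f q0 i := by
      intro i
      induction i with
      | zero => exact rfl
      | succ i ih =>
        rw [Function.iterate_succ_apply']
        exact ⟨_, ih, hn _ (h i ih)⟩
    refine ⟨tuple fun i => n^[i] q0, h, _, rfl, fun i => ?_, rfl⟩
    show n^[i + 1] q0 ∈ _
    rw [Function.iterate_succ_apply']
    exact hn _ (h i (hr i))

theorem mdom_diamondMap (f : MultiMap Baire Baire) : mdom (diamondMap f) = diamondDom f := by
  classical
  ext q0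
  constructor
  · rintro ⟨s, h, _⟩
    exact h
  · intro h
    have hs : ∀ q, ∃ r, q ∈ mdom (step f) → r ∈ step f q := fun q => by
      by_cases hq : q ∈ mdom (step f)
      · exact ⟨hq.choose, fun _ => hq.choose_spec⟩
      · exact ⟨q, fun h => absurd h hq⟩
    choose n hn using hs
    have hstep : ∀ k, (∀ i < k, n^[i] q0 ∈ mdom (step f)) →
        IsFiniteRun f k fun i => n^[i] q0 := by
      intro k hk i hi
      show n^[i + 1] q0 ∈ _
      rw [Function.iterate_succ_apply']
      exact hn _ (hk i hi)
    have hdom : ∀ k, (∀ i ≤ k, n^[i] q0 0 ≠ 0) → n^[k] q0 ∈ mdom (step f) := by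
      intro k
      induction k using Nat.strong_induction_on with
      | _ k ih =>
        intro h0
        by_contra hc
        exact h.1 ⟨k, _, rfl, hstep k fun i hi => ih i hi fun j hj => h0 j (by omega), hc, h0⟩
    by_cases hz : ∃ k, n^[k] q0 0 = 0
    · refine ⟨_, h, Nat.find hz, fun i => n^[i] q0, rfl, hstep _ fun i hi => hdom i fun j hj => ?_,
        ⟨Nat.find_spec hz, fun i hi => Nat.find_min hz hi⟩, rfl⟩
      exact Nat.find_min hz (by omega)
    · rw [not_exists] at hz
      refine absurd ⟨fun i => n^[i] q0, rfl, fun i => ?_, hz⟩ h.2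
      exact hstep (i + 1) (fun j _ => hdom j fun l _ => hz l) i (by omega)

/-- The inverse limit `f^∞` of a problem, through its realizer version. -/
def Problem.inverseLimit {X : Type u} {Y : Type v} (f : Problem X Y) : Problem Baire Baire :=
  Problem.onBaire (invLim f.realizerVersion)

/-- The diamond `f^◇` of a problem, through its realizer version. -/
def Problem.diamond {X : Type u} {Y : Type v} (f : Problem X Y) : Problem Baire Baire :=
  Problem.onBaire (diamondMap f.realizerVersion)

end Weihrauch

namespace Weihrauch

/-! Countably many runs of the loop on `f` can be interleaved in a single run. The big state carries
a counter `n` and the current states of all simulated runs; one pass advances run number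
`n.unpair.1` and increments the counter. Run `j` thus gets its turns exactly at the times `Nat.pair
j 0 < Nat.pair j 1 < ...`, and its `k`-th state is visible at time `Nat.pair j k`. Every pass uses
`f` once, on the instance of the active run, so the big run is a legitimate run on `f`.

The big state must itself be a program that produces the next big state. `exists_loop` achieves this
by self-application, as in the recursion theorem: a fixed program `e` is specialized to the argument
`⟨e, D⟩`, so it knows its own code and the data `D`. The data are also written into the program as
entries that assign only the empty word, hence they can be read off from every state of an infinite
run.

For (1), the instances of the parallelized inverse limit are fed in as initial states, and
`exists_simulation` recovers all their runs from one solution. For (3), a run that reaches a state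
beginning with `0` is frozen. Its later turns still need an answer of `f`, which is why pointedness
matters: it supplies a computable instance of the realizer version on which these turns are spent.
The output is found by searching each simulated run for a frozen state. Finally, (2) follows from
(3), because a problem on Baire space reduces to its parallelization. -/

theorem word_prefix_word (p : Baire) {m n : ℕ} (h : m ≤ n) : word p m <+: word p n := by
  obtain ⟨k, rfl⟩ := Nat.exists_eq_add_of_le h
  simp [word, List.range_add]

theorem take_word (p : Baire) {m n : ℕ} (h : m ≤ n) : (word p n).take m = word p m := by
  simp [word, ← List.map_take, List.take_range, h]

theorem word_succ (p : Baire) (n : ℕ) : word p (n + 1) = word p n ++ [p n] := by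
  simp [word, List.range_succ]

theorem word_getElem? (p : Baire) {n k : ℕ} (h : k < n) : (word p n)[k]? = some (p k) := by
  simp [word, h]

theorem word_getD (p : Baire) {n k : ℕ} (h : k < n) : (word p n).getD k 0 = p k := by
  simp [List.getD, word_getElem? p h]

/-! ### Computable functionals with parameters -/

/-- The total functional `F` with a discrete parameter is computable: its values are found from
prefixes of the argument, and all sufficiently long prefixes determine the value. -/
def ComputableFunctional {α σ : Type*} [Primcodable α] [Primcodable σ] (F : Baire → α → σ) : Prop :=
  ∃ θ : List ℕ → α → Option σ, Computable₂ θ ∧ ∀ p a,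
    (∀ k, ∀ y, θ (word p k) a = some y → y = F p a) ∧
      ∃ k₀, ∀ k, k₀ ≤ k → θ (word p k) a = some (F p a)

namespace ComputableFunctional

variable {α β σ τ : Type*} [Primcodable α] [Primcodable β] [Primcodable σ] [Primcodable τ]

theorem param {f : α → σ} (hf : Computable f) : ComputableFunctional fun _ a => f a :=
  ⟨fun _ a => some (f a), Computable.option_some.comp (hf.comp Computable.snd),
    fun _ _ => ⟨fun _ _ h => (Option.some.inj h).symm, 0, fun _ _ => rfl⟩⟩

theorem subst {F : Baire → β → σ} {N : Baire → α → β} (hF : ComputableFunctional F)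
    (hN : ComputableFunctional N) : ComputableFunctional fun p a => F p (N p a) := by
  obtain ⟨θ, hθ, h⟩ := hF
  obtain ⟨η, hη, h'⟩ := hN
  refine ⟨fun v a => (η v a).bind (θ v), ?_, fun p a => ⟨fun k y hy => ?_, ?_⟩⟩
  · have h1 : Computable fun x : (List ℕ × α) × β => θ x.1.1 x.2 :=
      hθ.comp (Computable.fst.comp Computable.fst) Computable.snd
    exact Computable.option_bind (f := fun x : List ℕ × α => η x.1 x.2) hη h1
  · obtain ⟨x, hx, hy⟩ := Option.bind_eq_some_iff.1 hy
    rw [(h p x).1 k y hy, (h' p a).1 k x hx]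
  · obtain ⟨k₀, hk⟩ := (h' p a).2
    obtain ⟨k₁, hk'⟩ := (h p (N p a)).2
    exact ⟨max k₀ k₁, fun k hkk => by
      simp [hk k (le_trans (le_max_left _ _) hkk), hk' k (le_trans (le_max_right _ _) hkk)]⟩

theorem comp_param {F : Baire → β → σ} (hF : ComputableFunctional F) {f : α → β}
    (hf : Computable f) : ComputableFunctional fun p a => F p (f a) :=
  hF.subst (param hf)

theorem comp₁ {F : Baire → α → σ} {f : σ → τ} (hf : Computable f) (hF : ComputableFunctional F) :
    ComputableFunctional fun p a => f (F p a) :=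
  (param hf).subst hF

theorem prod {F : Baire → α → σ} {G : Baire → α → τ} (hF : ComputableFunctional F)
    (hG : ComputableFunctional G) : ComputableFunctional fun p a => (F p a, G p a) := by
  obtain ⟨θ, hθ, h⟩ := hF
  obtain ⟨η, hη, h'⟩ := hG
  refine ⟨fun v a => (θ v a).bind fun x => (η v a).map fun y => (x, y), ?_,
    fun p a => ⟨fun k y hy => ?_, ?_⟩⟩
  · have h1 : Computable fun x : (List ℕ × α) × σ => η x.1.1 x.1.2 :=
      hη.comp (Computable.fst.comp Computable.fst) (Computable.snd.comp Computable.fst)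
    have h2 : Computable fun x : ((List ℕ × α) × σ) × τ => (x.1.2, x.2) :=
      Computable.pair (Computable.snd.comp Computable.fst) Computable.snd
    have h3 : Computable fun x : (List ℕ × α) × σ => (η x.1.1 x.1.2).map fun y => (x.2, y) :=
      Computable.option_map h1 h2
    exact Computable.option_bind (f := fun x : List ℕ × α => θ x.1 x.2) hθ h3
  · obtain ⟨x, hx, hy⟩ := Option.bind_eq_some_iff.1 hy
    obtain ⟨z, hz, rfl⟩ := Option.map_eq_some_iff.1 hy
    rw [(h p a).1 k x hx, (h' p a).1 k z hz]
  · obtain ⟨k₀, hk⟩ := (h p a).2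
    obtain ⟨k₁, hk'⟩ := (h' p a).2
    exact ⟨max k₀ k₁, fun k hkk => by
      simp [hk k (le_trans (le_max_left _ _) hkk), hk' k (le_trans (le_max_right _ _) hkk)]⟩

theorem comp₂ {F : Baire → α → σ} {G : Baire → α → τ} {f : σ → τ → β} (hf : Computable₂ f)
    (hF : ComputableFunctional F) (hG : ComputableFunctional G) :
    ComputableFunctional fun p a => f (F p a) (G p a) :=
  comp₁ (f := fun x : σ × τ => f x.1 x.2) hf (hF.prod hG)

theorem cond {c : Baire → α → Bool} {F G : Baire → α → σ} (hc : ComputableFunctional c)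
    (hF : ComputableFunctional F) (hG : ComputableFunctional G) :
    ComputableFunctional fun p a => bif c p a then F p a else G p a :=
  comp₁ (f := fun x : Bool × σ × σ => bif x.1 then x.2.1 else x.2.2)
    (Computable.cond Computable.fst (Computable.fst.comp Computable.snd)
      (Computable.snd.comp Computable.snd)) (hc.prod (hF.prod hG))

theorem prefixes : ComputableFunctional word := by
  refine ⟨fun v n => if n ≤ v.length then some (v.take n) else none,
    (Primrec.ite (Primrec.nat_le.comp Primrec.snd (Primrec.list_length.comp Primrec.fst))
      (Primrec.option_some.comp (Primrec.list_take.comp Primrec.snd Primrec.fst))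
      (Primrec.const none)).to_comp, fun p n => ⟨fun k y hy => ?_, n, fun k hk => ?_⟩⟩
  · dsimp only at hy
    rw [word_length] at hy
    split_ifs at hy with hnk
    rw [take_word p hnk] at hy
    exact (Option.some.inj hy).symm
  · simp [word_length, hk, take_word]

/-- Digits are obtained from prefixes: the prefix of length `F p a + 1` contains the digit at
position `F p a`. -/
theorem digit {F : Baire → α → ℕ} (hF : ComputableFunctional F) :
    ComputableFunctional fun p a => p (F p a) := by
  have h := comp₂ (Primrec.list_getD 0).to_comp (prefixes.subst (comp₁ Computable.succ hF)) hF
  convert h using 3 with p a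
  exact (word_getD p (Nat.lt_succ_self _)).symm

end ComputableFunctional

/-! ### Computability of partial functions by search -/

/-- `r` is the outcome of the search `g` at `p`: digit `n` of `r` is the only value that `g` offers
for `n`. -/
def SearchSpec (g : Baire → ℕ × ℕ → Option ℕ) (p r : Baire) : Prop :=
  ∀ n, (∃ i, g p (n, i) = some (r n)) ∧ ∀ i y, g p (n, i) = some y → y = r n

/-- The word that arises if `θ` is asked for the next digit at each of the first `n` prefixes of
`v`. -/
def digitsUpTo (θ : List ℕ → ℕ → Option ℕ) (v : List ℕ) (n : ℕ) : List ℕ :=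
  Nat.rec [] (fun k w => ((θ (v.take (k + 1)) w.length).map fun y => w ++ [y]).getD w) n

/-- The word function that appends a digit whenever `θ` provides the next one. -/
def appendDigits (θ : List ℕ → ℕ → Option ℕ) (v : List ℕ) : List ℕ := digitsUpTo θ v v.length

theorem digitsUpTo_succ (θ : List ℕ → ℕ → Option ℕ) (v : List ℕ) (n : ℕ) :
    digitsUpTo θ v (n + 1) = ((θ (v.take (n + 1)) (digitsUpTo θ v n).length).map
      fun y => digitsUpTo θ v n ++ [y]).getD (digitsUpTo θ v n) := rfl

theorem digitsUpTo_eq_of_prefix (θ : List ℕ → ℕ → Option ℕ) {v w : List ℕ} (h : v <+: w) {n : ℕ}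
    (hn : n ≤ v.length) : digitsUpTo θ v n = digitsUpTo θ w n := by
  induction n with
  | zero => rfl
  | succ n ih =>
    have ht : v.take (n + 1) = w.take (n + 1) := by
      rw [List.prefix_iff_eq_take.1 h, List.take_take, min_eq_left hn]
    rw [digitsUpTo_succ, digitsUpTo_succ, ht, ih (by omega)]

/-- The last value that `θ` offers at an index below the length of the word. -/
def lastOffer (θ : List ℕ → ℕ × ℕ → Option (Option ℕ)) (v : List ℕ) (n : ℕ) : Option ℕ :=
  Nat.rec none (fun i y => ((θ v (n, i)).bind id).or y) v.length

theorem lastOffer_computable {θ : List ℕ → ℕ × ℕ → Option (Option ℕ)} (hθ : Computable₂ θ) :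
    Computable₂ (lastOffer θ) := by
  have h1 : Computable fun x : (List ℕ × ℕ) × ℕ × Option ℕ => θ x.1.1 (x.1.2, x.2.1) :=
    hθ.comp (Computable.fst.comp Computable.fst) (Computable.pair
      (Computable.snd.comp Computable.fst) (Computable.fst.comp Computable.snd))
  have h2 : Computable fun x : (List ℕ × ℕ) × ℕ × Option ℕ =>
      (θ x.1.1 (x.1.2, x.2.1)).bind id := Computable.option_bind h1 Computable.snd.to₂
  have h3 : Computable fun x : (List ℕ × ℕ) × ℕ × Option ℕ =>
      ((θ x.1.1 (x.1.2, x.2.1)).bind id).or x.2.2 := by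
    refine (Computable.option_casesOn h2 (Computable.snd.comp Computable.snd)
      (Computable.option_some.comp Computable.snd).to₂).of_eq fun x => ?_
    cases (θ x.1.1 (x.1.2, x.2.1)).bind id <;> rfl
  exact Computable.nat_rec (f := fun x : List ℕ × ℕ => x.1.length)
    (Computable.list_length.comp Computable.fst) (Computable.const none)
    (h := fun x y => ((θ x.1 (x.2, y.1)).bind id).or y.2) h3

theorem appendDigits_computable {θ : List ℕ → ℕ → Option ℕ} (hθ : Computable₂ θ) :
    Computable (appendDigits θ) := by
  have h1 : Computable fun x : List ℕ × ℕ × List ℕ => θ (x.1.take (x.2.1 + 1)) x.2.2.length :=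
    hθ.comp (Primrec.list_take.to_comp.comp (Computable.succ.comp
      (Computable.fst.comp Computable.snd)) Computable.fst)
      (Computable.list_length.comp (Computable.snd.comp Computable.snd))
  have h2 : Computable fun x : (List ℕ × ℕ × List ℕ) × ℕ => x.1.2.2 ++ [x.2] :=
    Computable.list_concat.comp (Computable.snd.comp (Computable.snd.comp Computable.fst))
      Computable.snd
  have h3 : Computable fun x : List ℕ × ℕ × List ℕ =>
      ((θ (x.1.take (x.2.1 + 1)) x.2.2.length).map fun y => x.2.2 ++ [y]).getD x.2.2 :=
    Computable.option_getD (Computable.option_map h1 h2) (Computable.snd.comp Computable.snd)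
  exact Computable.nat_rec (f := List.length) Computable.list_length (Computable.const [])
    (h := fun v (x : ℕ × List ℕ) =>
      ((θ (v.take (x.1 + 1)) x.2.length).map fun y => x.2 ++ [y]).getD x.2) h3

theorem appendDigits_monotone (θ : List ℕ → ℕ → Option ℕ) : MonotoneWord (appendDigits θ) := by
  intro v w hvw
  have h2 : ∀ k, digitsUpTo θ w v.length <+: digitsUpTo θ w (v.length + k) := by
    intro k
    -- Reading one more letter appends at most one digit and never erases any.
    induction k with
    | zero => exact List.prefix_refl _
    | succ k ih =>
      refine ih.trans ?_
      rw [← Nat.add_assoc, digitsUpTo_succ]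
      cases θ (w.take (v.length + k + 1)) (digitsUpTo θ w (v.length + k)).length <;> simp
  obtain ⟨k, hk⟩ := Nat.exists_eq_add_of_le hvw.length_le
  rw [appendDigits, appendDigits, digitsUpTo_eq_of_prefix θ hvw le_rfl, hk]
  exact h2 k

/-- The answers of `θ` may lapse on longer prefixes, and outside the domain of `F` they may
contradict each other. Emitting everything currently known would therefore not be monotone;
`appendDigits` instead replays the history of the word and only ever appends. On the domain each
offered digit is correct and is eventually offered at all longer prefixes, so the output grows to `F
p`. -/
theorem IsComputable.of_search {g : Baire → ℕ × ℕ → Option ℕ} (hg : ComputableFunctional g)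
    {F : Baire →. Baire} (hF : ∀ p r, r ∈ F p → SearchSpec g p r) : IsComputable F := by
  obtain ⟨θ, hθ, h⟩ := hg
  refine ⟨appendDigits (lastOffer θ), appendDigits_computable (lastOffer_computable hθ),
    appendDigits_monotone _, fun p r hr => ?_⟩
  have hS := hF p r hr
  have hval : ∀ k n y, lastOffer θ (word p k) n = some y → y = r n := by
    intro k n y
    unfold lastOffer
    generalize (word p k).length = l
    induction l with
    | zero => intro h; simp at h
    | succ l ih =>
      intro hy
      change ((θ (word p k) (n, l)).bind id).or _ = some y at hy
      rcases Option.or_eq_some_iff.1 hy with hy | ⟨_, hy⟩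
      · obtain ⟨z, hz, hzy⟩ := Option.bind_eq_some_iff.1 hy
        exact (hS n).2 l y (((h p (n, l)).1 k z hz).symm.trans hzy)
      · exact ih hy
  have hex : ∀ n, ∃ k₀, ∀ k, k₀ ≤ k → lastOffer θ (word p k) n = some (r n) := by
    intro n
    obtain ⟨i, hi⟩ := (hS n).1
    obtain ⟨k₀, hk₀⟩ := (h p (n, i)).2
    -- The prefix must be long enough for `θ` to answer at `(n, i)`, and longer than `i` so that
    -- `lastOffer` inspects that index.
    refine ⟨max k₀ (i + 1), fun k hk => ?_⟩
    have h1 := hk₀ k (le_trans (le_max_left _ _) hk)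
    have h2 : i < k := le_trans (le_max_right _ _) hk
    suffices hsome : (lastOffer θ (word p k) n).isSome by
      obtain ⟨y, hy⟩ := Option.isSome_iff_exists.1 hsome
      rw [hy, hval k n y hy]
    unfold lastOffer
    rw [word_length]
    -- The prefix is frozen so that the induction concerns only the bound of the recursion.
    generalize word p k = v at h1
    clear hk
    induction k, h2 using Nat.le_induction with
    | base => simp [h1, hi]
    | succ l _ ih =>
      change (((θ v (n, l)).bind id).or _).isSome = true
      rw [Option.isSome_or, ih, Bool.or_true]
  set η := lastOffer θ with hη
  have hstep : ∀ k, appendDigits η (word p (k + 1)) =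
      ((η (word p (k + 1)) (appendDigits η (word p k)).length).map
        fun y => appendDigits η (word p k) ++ [y]).getD (appendDigits η (word p k)) := by
    intro k
    simp only [appendDigits, word_length]
    rw [digitsUpTo_succ, take_word p le_rfl, ← digitsUpTo_eq_of_prefix η
      (word_prefix_word p (Nat.le_succ k)) (word_length p k).ge]
  have hpre : ∀ k, ∃ m, appendDigits η (word p k) = word r m := by
    intro k
    induction k with
    | zero => exact ⟨0, rfl⟩
    | succ k ih =>
      obtain ⟨m, hm⟩ := ih
      rw [hstep, hm, word_length]
      cases hy : η (word p (k + 1)) m with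
      | none => exact ⟨m, rfl⟩
      | some y => exact ⟨m + 1, by rw [word_succ, ← hval _ _ _ hy]; rfl⟩
  have hlen : ∀ m, ∃ k, m ≤ (appendDigits η (word p k)).length := by
    intro m
    induction m with
    | zero => exact ⟨0, Nat.zero_le _⟩
    | succ m ih =>
      obtain ⟨k, hk⟩ := ih
      obtain ⟨k₀, hk₀⟩ := hex m
      have hmono := (appendDigits_monotone η _ _ (word_prefix_word p (le_max_left k k₀))).length_le
      -- By stage `max k k₀` the output already has more than `m` digits, or it has exactly `m` and
      -- the next stage is certain to supply digit `m`.
      refine ⟨max k k₀ + 1, ?_⟩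
      rw [hstep]
      rcases (hk.trans hmono).lt_or_eq with hlt | heq
      · cases η (word p (max k k₀ + 1)) (appendDigits η (word p (max k k₀))).length <;>
          simp <;> omega
      · rw [← heq, hk₀ _ (le_trans (le_max_right k k₀) (Nat.le_succ _))]
        simp [← heq]
  refine ⟨?_, fun m => ?_⟩
  · rintro w ⟨k, rfl⟩
    exact hpre k
  · obtain ⟨k, hk⟩ := hlen m
    obtain ⟨m', hm'⟩ := hpre k
    refine ⟨_, ⟨k, rfl⟩, ?_⟩
    rw [hm'] at hk ⊢
    exact word_prefix_word r (by rwa [word_length] at hk)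

/-- Total functions on Baire space as partial functions. -/
def total (F : Baire → Baire) : Baire →. Baire := fun p => Part.some (F p)

theorem IsComputable.comp {F G : Baire →. Baire} (hF : IsComputable F) (hG : IsComputable G) :
    IsComputable fun p => (G p).bind F := by
  obtain ⟨h, hh, hm, ha⟩ := hF
  obtain ⟨k, hk, km, ka⟩ := hG
  refine ⟨fun v => h (k v), hh.comp hk, fun v w hvw => hm _ _ (km _ _ hvw), fun p r hr => ?_⟩
  obtain ⟨q, hq, hr⟩ := Part.mem_bind_iff.1 hr
  have h1 := ka p q hq
  have h2 := ha q r hr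
  refine ⟨?_, fun m => ?_⟩
  · rintro w ⟨n, rfl⟩
    obtain ⟨m, hm⟩ := h1.1 _ ⟨n, rfl⟩
    exact h2.1 _ ⟨m, congrArg h hm⟩
  · obtain ⟨_, ⟨n, rfl⟩, hn⟩ := h2.2 m
    obtain ⟨_, ⟨l, rfl⟩, hl⟩ := h1.2 n
    exact ⟨_, ⟨l, rfl⟩, hn.trans (hm _ _ hl)⟩

theorem ComputableFunctional.isComputable {F : Baire → Baire} (hF : ComputableFunctional F) :
    IsComputable (total F) := by
  refine IsComputable.of_search (g := fun p a => some (F p a.1))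
    ((hF.comp_param Computable.fst).comp₁ Computable.option_some) fun p r hr n => ?_
  obtain rfl := Part.mem_some_iff.1 hr
  exact ⟨⟨0, rfl⟩, fun _ _ h => (Option.some.inj h).symm⟩

namespace ComputableFunctional

variable {α σ : Type*} [Primcodable α] [Primcodable σ]

/-- A word function for `G` turns prefixes of `p` into prefixes of `G p` of unbounded length, and
`θ` is consulted on those. -/
theorem comp_left {F : Baire → α → σ} (hF : ComputableFunctional F) {G : Baire → Baire}
    (hG : ComputableFunctional G) : ComputableFunctional fun p a => F (G p) a := by
  obtain ⟨θ, hθ, h⟩ := hF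
  obtain ⟨k, hk, km, ka⟩ := hG.isComputable
  refine ⟨fun v a => θ (k v) a, hθ.comp (hk.comp Computable.fst) Computable.snd, fun p a => ?_⟩
  have hs := ka p (G p) (Part.mem_some _)
  refine ⟨fun n y hy => ?_, ?_⟩
  · obtain ⟨m, hm⟩ := hs.1 _ ⟨n, rfl⟩
    exact (h (G p) a).1 m y (hm ▸ hy)
  · obtain ⟨k₀, hk₀⟩ := (h (G p) a).2
    obtain ⟨_, ⟨n, rfl⟩, hn⟩ := hs.2 k₀
    refine ⟨n, fun l hl => ?_⟩
    obtain ⟨m, hm⟩ := hs.1 _ ⟨l, rfl⟩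
    have hle := (hn.trans (km _ _ (word_prefix_word p hl))).length_le
    rw [hm, word_length, word_length] at hle
    change θ (k (word p l)) a = _
    rw [hm]
    exact hk₀ m hle

theorem reindex {f : ℕ → ℕ} (hf : Computable f) :
    ComputableFunctional fun (p : Baire) n => p (f n) := digit (param hf)

theorem id' : ComputableFunctional fun p : Baire => p := reindex Computable.id

theorem const {d : Baire} (hd : Computable d) : ComputableFunctional fun _ : Baire => d := param hd

theorem fstB' : ComputableFunctional fstB :=
  reindex (Primrec.nat_mul.comp (Primrec.const 2) Primrec.id).to_comp

theorem sndB' : ComputableFunctional sndB :=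
  reindex (Primrec.succ.comp (Primrec.nat_mul.comp (Primrec.const 2) Primrec.id)).to_comp

theorem pair' {F G : Baire → Baire} (hF : ComputableFunctional F) (hG : ComputableFunctional G) :
    ComputableFunctional fun p => pair (F p) (G p) := by
  have hd : Computable fun n : ℕ => n / 2 :=
    (Primrec.nat_div.comp Primrec.id (Primrec.const 2)).to_comp
  have hc : Computable fun n : ℕ => decide (n % 2 = 0) :=
    (PrimrecPred.decide (Primrec.eq.comp (Primrec.nat_mod.comp Primrec.id (Primrec.const 2))
      (Primrec.const 0))).to_comp
  convert cond (param hc) (hF.comp_param hd) (hG.comp_param hd) using 3 with p n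
  by_cases h : n % 2 = 0 <;> simp [pair, h]

end ComputableFunctional

/-! ### Evaluating programs -/

/-- The pair of words that a digit of a program stands for. -/
def listedAt (d : ℕ) : Option (List ℕ × List ℕ) :=
  (Encodable.decode (d - 3)).bind fun z : List ℕ × List ℕ =>
    -- Subtraction is truncated, so without this test the dummy digits `0,1,2` would be read as the
    -- code `0`.
    if Encodable.encode z + 3 = d then some z else none

theorem listedAt_eq_some {d : ℕ} {z : List ℕ × List ℕ} :
    listedAt d = some z ↔ d = Encodable.encode z + 3 := by
  unfold listedAt
  constructor
  · intro h
    obtain ⟨y, _, hy⟩ := Option.bind_eq_some_iff.1 h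
    split_ifs at hy with hd
    rw [← Option.some.inj hy, hd]
  · rintro rfl
    rw [Nat.add_sub_cancel, Encodable.encodek]
    simp

theorem listedAt_primrec : Primrec listedAt := by
  have h1 : Primrec fun d : ℕ => (Encodable.decode (d - 3) : Option (List ℕ × List ℕ)) :=
    Primrec.decode.comp (Primrec.nat_sub.comp Primrec.id (Primrec.const 3))
  have h2 : Primrec fun x : ℕ × (List ℕ × List ℕ) =>
      if Encodable.encode x.2 + 3 = x.1 then some x.2 else none :=
    Primrec.ite (Primrec.eq.comp (Primrec.nat_add.comp (Primrec.encode.comp Primrec.snd)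
      (Primrec.const 3)) Primrec.fst) (Primrec.option_some.comp Primrec.snd) (Primrec.const none)
  exact Primrec.option_bind h1 h2

/-- The digit `a.1` that the entry `a.2` of the program `q` provides at the argument `p`. -/
def phiSearch (q p : Baire) (a : ℕ × ℕ) : Option ℕ :=
  (listedAt (q a.2)).bind fun z => if z.1 = word p z.1.length then z.2[a.1]? else none

/-- All words listed for prefixes of `p` are prefixes of the same `r`, so different entries cannot
disagree on a digit. -/
theorem searchSpec_phiSearch {q p r : Baire} (h : r ∈ Phi q p) (n : ℕ) :
    (∃ i, phiSearch q p (n, i) = some (r n)) ∧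
      ∀ i y, phiSearch q p (n, i) = some y → y = r n := by
  rw [mem_Phi] at h
  constructor
  · obtain ⟨w, ⟨m, i, hi⟩, hw⟩ := h.2 (n + 1)
    obtain ⟨l, rfl⟩ := h.1 w ⟨m, i, hi⟩
    refine ⟨i, ?_⟩
    have hl := hw.length_le
    rw [word_length, word_length] at hl
    rw [phiSearch, listedAt_eq_some.2 hi]
    simp [word_length, word_getElem? r hl]
  · intro i y hy
    obtain ⟨z, hz, hy⟩ := Option.bind_eq_some_iff.1 hy
    split_ifs at hy with hc
    obtain ⟨l, hl⟩ := h.1 z.2 ⟨z.1.length, i, by rw [← hc]; exact listedAt_eq_some.1 hz⟩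
    rw [hl] at hy
    have hn : n < l := by
      by_contra hn
      rw [List.getElem?_eq_none (by rw [word_length]; omega)] at hy
      simp at hy
    rw [word_getElem? r hn] at hy
    exact (Option.some.inj hy).symm

theorem phiSearch_computable {A B : Baire → Baire} (hA : ComputableFunctional A)
    (hB : ComputableFunctional B) : ComputableFunctional fun p => phiSearch (A p) (B p) := by
  have h1 : ComputableFunctional fun p (a : ℕ × ℕ) => listedAt (A p a.2) :=
    (hA.comp_param Computable.snd).comp₁ listedAt_primrec.to_comp
  have h2 : Primrec fun o : Option (List ℕ × List ℕ) => (o.map fun z => z.1.length).getD 0 :=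
    Primrec.option_getD.comp (Primrec.option_map Primrec.id
      (Primrec.list_length.comp (Primrec.fst.comp Primrec.snd)).to₂) (Primrec.const 0)
  have h3 : ComputableFunctional fun p (a : ℕ × ℕ) =>
      word (B p) (((listedAt (A p a.2)).map fun z => z.1.length).getD 0) :=
    (ComputableFunctional.prefixes.comp_left hB).subst (h1.comp₁ h2.to_comp)
  have h4 : Primrec fun x : (ℕ × Option (List ℕ × List ℕ)) × List ℕ =>
      x.1.2.bind fun z => if z.1 = x.2 then z.2[x.1.1]? else none := by
    refine Primrec.option_bind (Primrec.snd.comp Primrec.fst) ?_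
    exact Primrec.ite (Primrec.eq.comp (Primrec.fst.comp Primrec.snd)
        (Primrec.snd.comp Primrec.fst))
      (Primrec.list_getElem?.comp (Primrec.snd.comp Primrec.snd)
        (Primrec.fst.comp (Primrec.fst.comp Primrec.fst))) (Primrec.const none)
  convert (((ComputableFunctional.param Computable.fst).prod h1).prod h3).comp₁ h4.to_comp
    using 3 with p a
  unfold phiSearch
  cases listedAt (A p a.2) <;> rfl

/-- The component `C p` is carried along so that a loop program still has its own code and data
after it has run another program. Even digits come from `C p`, odd ones from the search. -/
theorem isComputable_phi {A B C : Baire → Baire} (hA : ComputableFunctional A)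
    (hB : ComputableFunctional B) (hC : ComputableFunctional C) :
    IsComputable fun p => (Phi (A p) (B p)).map fun u => pair (C p) u := by
  have hd : Computable fun a : ℕ × ℕ => (a.1 / 2, a.2) :=
    (Primrec.pair (Primrec.nat_div.comp Primrec.fst (Primrec.const 2)) Primrec.snd).to_comp
  have hc : Computable fun a : ℕ × ℕ => decide (a.1 % 2 = 0) :=
    (PrimrecPred.decide (Primrec.eq.comp (Primrec.nat_mod.comp Primrec.fst (Primrec.const 2))
      (Primrec.const 0))).to_comp
  refine IsComputable.of_search (.cond (.param hc)
    (.comp₁ Computable.option_some (hC.comp_param (Computable.fst.comp hd)))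
    ((phiSearch_computable hA hB).comp_param hd)) fun p r hr n => ?_
  obtain ⟨u, hu, rfl⟩ := (Part.mem_map_iff _).1 hr
  by_cases hn : n % 2 = 0
  · simp [pair, hn, eq_comm]
  · simpa [pair, hn] using searchSpec_phiSearch hu (n / 2)

/-! ### Writing programs -/

/-- Every computable function has a computable program. -/
theorem IsComputable.exists_program {F : Baire →. Baire} (hF : IsComputable F) :
    ∃ e : Baire, Computable e ∧ ∀ p r, r ∈ F p → r ∈ Phi e p := by
  obtain ⟨h, hh, -, ha⟩ := hF
  -- The program lists `(v, h v)` for all words `v`, shifted past the dummy digits.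
  refine ⟨fun i => Encodable.encode (Denumerable.ofNat (List ℕ) i,
    h (Denumerable.ofNat (List ℕ) i)) + 3, ?_, fun p r hr => ?_⟩
  · have h1 : Computable (Denumerable.ofNat (List ℕ)) := by
      refine Computable.option_some_iff.1 ((Computable.decode (α := List ℕ)).of_eq fun n => ?_)
      exact Denumerable.decode_eq_ofNat _ _
    exact (Primrec.nat_add.comp Primrec.id (Primrec.const 3)).to_comp.comp
      (Computable.encode.comp (h1.pair (hh.comp h1)))
  · rw [mem_Phi]
    convert ha p r hr using 1
    ext w
    constructor
    · rintro ⟨n, i, hi⟩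
      have := Encodable.encode_injective (Nat.add_right_cancel hi)
      obtain ⟨h1, h2⟩ := Prod.mk.inj this
      exact ⟨n, by rw [← h2, h1]⟩
    · rintro ⟨n, rfl⟩
      exact ⟨n, Encodable.encode (word p n), by simp only [Denumerable.ofNat_encode]⟩

/-- The digits at even positions. -/
def evens (v : List ℕ) : List ℕ := (List.range ((v.length + 1) / 2)).map fun j => v.getD (2 * j) 0

/-- The digits at odd positions. -/
def odds (v : List ℕ) : List ℕ := (List.range (v.length / 2)).map fun j => v.getD (2 * j + 1) 0

theorem evens_primrec : Primrec evens :=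
  Primrec.list_map (Primrec.list_range.comp (Primrec.nat_div.comp
    (Primrec.succ.comp Primrec.list_length) (Primrec.const 2)))
    ((Primrec.list_getD 0).comp Primrec.fst
      (Primrec.nat_mul.comp (Primrec.const 2) Primrec.snd)).to₂

theorem odds_primrec : Primrec odds :=
  Primrec.list_map (Primrec.list_range.comp (Primrec.nat_div.comp
    Primrec.list_length (Primrec.const 2)))
    ((Primrec.list_getD 0).comp Primrec.fst
      (Primrec.succ.comp (Primrec.nat_mul.comp (Primrec.const 2) Primrec.snd))).to₂

theorem evens_word (s : Baire) (n : ℕ) : evens (word s n) = word (fstB s) ((n + 1) / 2) := by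
  unfold evens
  rw [word_length]
  refine List.map_congr_left fun j hj => ?_
  rw [List.mem_range] at hj
  exact word_getD s (by omega)

theorem odds_word (s : Baire) (n : ℕ) : odds (word s n) = word (sndB s) (n / 2) := by
  unfold odds
  rw [word_length]
  refine List.map_congr_left fun j hj => ?_
  rw [List.mem_range] at hj
  exact word_getD s (by omega)

theorem eq_word_of_evens_odds {v : List ℕ} {s : Baire}
    (he : evens v = word (fstB s) ((v.length + 1) / 2))
    (ho : odds v = word (sndB s) (v.length / 2)) : v = word s v.length := by
  refine List.ext_getElem (word_length _ _).symm fun m hm hm' => ?_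
  rw [word_getElem]
  have hg : v[m] = v.getD m 0 := by simp [hm]
  rw [hg]
  rcases Nat.even_or_odd' m with ⟨j, rfl | rfl⟩
  · exact List.map_inj_left.1 he j (List.mem_range.2 (by omega))
  · exact List.map_inj_left.1 ho j (List.mem_range.2 (by omega))

/-- The digit that specializes a listed pair to arguments with first component `p`, where `u` is
the relevant prefix of `p`. -/
def specializeDigit (z : Option (List ℕ × List ℕ)) (u : List ℕ) : ℕ :=
  (z.bind fun z => if evens z.1 = u then some (Encodable.encode (odds z.1, z.2) + 3)
    else none).getD 0

/-- The program that applies the program `fstB x` with `x` itself as first argument. -/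
def specialize (x : Baire) : Baire := fun i =>
  specializeDigit (listedAt (fstB x i))
    (word x (((listedAt (fstB x i)).map fun z => (z.1.length + 1) / 2).getD 0))

theorem specializeDigit_primrec : Primrec₂ specializeDigit := by
  have h1 : Primrec fun x : (Option (List ℕ × List ℕ) × List ℕ) × (List ℕ × List ℕ) =>
      if evens x.2.1 = x.1.2 then some (Encodable.encode (odds x.2.1, x.2.2) + 3) else none :=
    Primrec.ite (Primrec.eq.comp (evens_primrec.comp (Primrec.fst.comp Primrec.snd))
        (Primrec.snd.comp Primrec.fst))
      (Primrec.option_some.comp (Primrec.nat_add.comp (Primrec.encode.comp (Primrec.pair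
        (odds_primrec.comp (Primrec.fst.comp Primrec.snd)) (Primrec.snd.comp Primrec.snd)))
        (Primrec.const 3))) (Primrec.const none)
  exact Primrec.option_getD.comp (Primrec.option_bind Primrec.fst h1) (Primrec.const 0)

theorem specialize_computable : ComputableFunctional specialize := by
  have h1 : ComputableFunctional fun x i => listedAt (fstB x i) :=
    ComputableFunctional.fstB'.comp₁ listedAt_primrec.to_comp
  have h2 : Primrec fun o : Option (List ℕ × List ℕ) =>
      (o.map fun z => (z.1.length + 1) / 2).getD 0 :=
    Primrec.option_getD.comp (Primrec.option_map Primrec.id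
      (Primrec.nat_div.comp (Primrec.succ.comp (Primrec.list_length.comp
        (Primrec.fst.comp Primrec.snd))) (Primrec.const 2)).to₂) (Primrec.const 0)
  exact ComputableFunctional.comp₂ (f := specializeDigit) specializeDigit_primrec.to_comp h1
    (ComputableFunctional.prefixes.subst (h1.comp₁ h2.to_comp))

/-- A prefix of `pair x r` splits into a prefix of `x` at the even positions and one of `r` at the
odd positions. Entries whose even part disagrees with `x` become the dummy digit `0`. -/
theorem listed_specialize (x r : Baire) : listed (specialize x) r = listed (fstB x) (pair x r) := by
  ext w
  constructor
  · rintro ⟨n, i, hi⟩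
    unfold specialize at hi
    cases hz : listedAt (fstB x i) with
    | none => simp [hz, specializeDigit] at hi
    | some z =>
      have hd := listedAt_eq_some.1 hz
      rw [hz] at hi
      simp only [specializeDigit, Option.bind_some, Option.map_some, Option.getD_some] at hi
      split_ifs at hi with he
      · have := Encodable.encode_injective (Nat.add_right_cancel hi)
        obtain ⟨h1, h2⟩ := Prod.mk.inj this
        have hn : z.1.length / 2 = n := by
          have := congrArg List.length h1
          simpa [odds, word_length] using this
        refine ⟨z.1.length, i, ?_⟩
        rw [← eq_word_of_evens_odds (s := pair x r) (by rw [he, fstB_pair])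
          (by rw [h1, sndB_pair, hn]), ← h2]
        exact hd
      · simp at hi
  · rintro ⟨n, i, hi⟩
    refine ⟨n / 2, i, ?_⟩
    unfold specialize
    rw [listedAt_eq_some.2 hi]
    simp [specializeDigit, evens_word, odds_word, fstB_pair, sndB_pair, word_length]

theorem phi_specialize (x r : Baire) : Phi (specialize x) r = Phi (fstB x) (pair x r) := by
  unfold Phi
  rw [listed_specialize]

/-- The list that assigns the empty word to the words of length one given by the digits of `p`. -/
def idle (p : Baire) : Baire := fun n => Encodable.encode ([p n], ([] : List ℕ)) + 3

/-- The inverse of `idle` on digits. -/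
def unidle (d : ℕ) : ℕ := ((d - 3).unpair.1 - 1).unpair.1

/-- The code of `[a]` is the successor of the pair of `a` and the code of `[]`; this explains the
predecessor between the two unpairings in `unidle`. -/
theorem unidle_idle (p : Baire) (n : ℕ) : unidle (idle p n) = p n := by
  simp [unidle, idle, Encodable.encode_prod_val, Encodable.encode_list_cons]

theorem unidle_primrec : Primrec unidle :=
  Primrec.fst.comp (Primrec.unpair.comp (Primrec.nat_sub.comp (Primrec.fst.comp
    (Primrec.unpair.comp (Primrec.nat_sub.comp Primrec.id (Primrec.const 3)))) (Primrec.const 1)))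

theorem idle_computable : ComputableFunctional idle := by
  have h : Primrec fun d : ℕ => Encodable.encode ([d], ([] : List ℕ)) + 3 :=
    Primrec.nat_add.comp (Primrec.encode.comp (Primrec.pair
      (Primrec.list_cons.comp Primrec.id (Primrec.const [])) (Primrec.const []))) (Primrec.const 3)
  exact ComputableFunctional.comp₁ (f := fun d : ℕ => Encodable.encode ([d], ([] : List ℕ)) + 3)
    h.to_comp ComputableFunctional.id'

/-- The additional entries assign only the empty word, which does not affect a supremum. A program
can thus store arbitrary data. -/
theorem mem_phi_pair_idle {p q s r : Baire} (h : r ∈ Phi q s) : r ∈ Phi (pair (idle p) q) s := by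
  rw [mem_Phi] at h ⊢
  have hsub : listed q s ⊆ listed (pair (idle p) q) s := by
    rintro w ⟨n, i, hi⟩
    exact ⟨n, 2 * i + 1, by rw [← hi]; exact congrFun (sndB_pair _ _) i⟩
  refine ⟨?_, fun m => ?_⟩
  · rintro w ⟨n, i, hi⟩
    rcases Nat.even_or_odd' i with ⟨j, rfl | rfl⟩
    · have h1 : pair (idle p) q (2 * j) = idle p j := congrFun (fstB_pair _ _) j
      rw [h1] at hi
      have := Encodable.encode_injective (Nat.add_right_cancel hi)
      exact ⟨0, (Prod.mk.inj this).2.symm⟩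
    · have h1 : pair (idle p) q (2 * j + 1) = q j := congrFun (sndB_pair _ _) j
      exact h.1 w ⟨n, j, h1 ▸ hi⟩
  · obtain ⟨w, hw, hm⟩ := h.2 m
    exact ⟨w, hsub hw, hm⟩

/-! ### Loop states that reproduce themselves -/

/-- States for a loop with data `D`: the loop presents `b D` as an instance, runs the program
`A D` on the answer and combines the old data and the outcome with `m`. -/
theorem exists_loop {A b m : Baire → Baire} (hA : ComputableFunctional A)
    (hb : ComputableFunctional b) (hm : ComputableFunctional m) :
    ∃ E : Baire → Baire, ComputableFunctional E ∧ (∀ D, sndB (E D) = b D) ∧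
      (∀ D k, unidle (E D (4 * k)) = D k) ∧
      ∀ D r u, u ∈ Phi (A D) r → E (m (pair D u)) ∈ Phi (fstB (E D)) r := by
  open ComputableFunctional in
  -- The argument `x` stands for `⟨e, D⟩`. Since `specialize x` hands `x` to `e`, the code `e` can
  -- be chosen afterwards and still have access to itself.
  set E : Baire → Baire := fun x => pair (pair (idle (sndB x)) (specialize x)) (b (sndB x)) with hE
  have hEc : ComputableFunctional E :=
    ((idle_computable.comp_left sndB').pair' specialize_computable).pair' (hb.comp_left sndB')
  set G : Baire → Baire := fun w =>
    E (pair (fstB (fstB w)) (m (pair (sndB (fstB w)) (sndB w)))) with hG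
  have hGc : ComputableFunctional G :=
    hEc.comp_left ((fstB'.comp_left fstB').pair' (hm.comp_left
      ((sndB'.comp_left fstB').pair' sndB')))
  have hT := hGc.isComputable.comp (isComputable_phi (A := fun t => A (sndB (fstB t)))
    (hA.comp_left (sndB'.comp_left fstB')) sndB' fstB')
  obtain ⟨e, he, hphi⟩ := hT.exists_program
  refine ⟨fun D => E (pair e D), hEc.comp_left ((const he).pair' id'), fun D => ?_, fun D k => ?_,
    fun D r u hu => ?_⟩
  · simp [hE, sndB_pair]
  · have h1 : E (pair e D) (4 * k) = fstB (fstB (E (pair e D))) k := by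
      -- The data sit in the first component of the first component, hence at every fourth digit.
      simp only [fstB]; congr 1; ring
    change unidle (E (pair e D) (4 * k)) = D k
    rw [h1]
    simp only [hE, fstB_pair, sndB_pair]
    exact unidle_idle D k
  · have h1 : fstB (E (pair e D)) = pair (idle D) (specialize (pair e D)) := by
      simp only [hE, fstB_pair, sndB_pair]
    rw [h1]
    refine mem_phi_pair_idle ?_
    rw [phi_specialize, fstB_pair]
    refine hphi _ _ (Part.mem_bind_iff.2 ⟨pair (pair e D) u, ?_, ?_⟩)
    · refine (Part.mem_map_iff _).2 ⟨u, ?_, ?_⟩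
      · simpa only [fstB_pair, sndB_pair] using hu
      · simp only [fstB_pair]
    · simp [total, hG, fstB_pair, sndB_pair]

/-! ### Interleaving countably many runs in one run -/

theorem mem_step {f : MultiMap Baire Baire} {q s : Baire} : s ∈ step f q ↔
    (∀ r ∈ f (sndB q), ∃ t, t ∈ Phi (fstB q) r) ∧ ∃ r ∈ f (sndB q), s ∈ Phi (fstB q) r := by
  constructor
  · rintro ⟨h, y, ⟨r, hr, rfl⟩, hs⟩
    refine ⟨fun r' hr' => ?_, r, hr, ?_⟩
    · obtain ⟨t, ht⟩ := h ⟨r', hr', rfl⟩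
      refine ⟨t, ?_⟩
      simpa [ofPFun, universal, fstB_pair, sndB_pair] using ht
    · simpa [ofPFun, universal, fstB_pair, sndB_pair] using hs
  · rintro ⟨h, r, hr, hs⟩
    refine ⟨?_, _, ⟨r, hr, rfl⟩, ?_⟩
    · rintro _ ⟨r', hr', rfl⟩
      obtain ⟨t, ht⟩ := h r' hr'
      refine ⟨t, ?_⟩
      simpa [ofPFun, universal, fstB_pair, sndB_pair] using ht
    · simpa [ofPFun, universal, fstB_pair, sndB_pair] using hs

/-- One pass of the loop on `f`. If `z` is set, states that start with `0` are kept. -/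
noncomputable def haltStep (z : Bool) (f : MultiMap Baire Baire) : MultiMap Baire Baire :=
  fun q => if z = true ∧ q 0 = 0 then {q} else step f q

/-- The list of all pairs `([], 0...0)`. -/
def zeroProgram : Baire := fun i => Encodable.encode (([] : List ℕ), word (fun _ => 0) i) + 3

theorem zeroProgram_computable : Computable zeroProgram :=
  (Primrec.nat_add.comp (Primrec.encode.comp (Primrec.pair (Primrec.const [])
    (Primrec.list_map Primrec.list_range (Primrec.const 0).to₂))) (Primrec.const 3)).to_comp

/-- The turn of a frozen run needs a program that converges on every answer; its outcome is
discarded by `advance`. -/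
theorem mem_phi_zeroProgram (p : Baire) : (fun _ => 0) ∈ Phi zeroProgram p := by
  rw [mem_Phi]
  refine ⟨?_, fun m => ⟨_, ⟨0, m, rfl⟩, List.prefix_refl _⟩⟩
  rintro w ⟨n, i, hi⟩
  have := Encodable.encode_injective (Nat.add_right_cancel hi)
  exact ⟨i, (Prod.mk.inj this).2.symm⟩

/-- The sequence `n, c 0, c 1, ...`. -/
def cons (n : ℕ) (c : Baire) : Baire := fun k => Nat.casesOn k n c

/-- The simulated run that is treated next according to the data `D`. -/
def active (D : Baire) : ℕ := (D 0).unpair.1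

/-- The current state of the active run. -/
def activeState (D : Baire) : Baire := fun k => D (Nat.pair (active D) k + 1)

/-- Whether the active run is kept. -/
def halted (z : Bool) (D : Baire) : Bool := z && decide (activeState D 0 = 0)

/-- The program for the active run. -/
def activeProgram (z : Bool) (D : Baire) : Baire := fun k =>
  bif halted z D then zeroProgram k else fstB (activeState D) k

/-- The instance for the active run. -/
def activeInstance (z : Bool) (d D : Baire) : Baire := fun k =>
  bif halted z D then d k else sndB (activeState D) k

/-- The new data, if the active run continues with `sndB t`. -/
def advance (z : Bool) (t : Baire) : Baire := fun k =>
  bif decide (k = 0) then fstB t 0 + 1 else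
    bif decide ((k - 1).unpair.1 = active (fstB t)) && !halted z (fstB t) then
      sndB t (k - 1).unpair.2 else fstB t k

section

open ComputableFunctional

theorem active_computable : ComputableFunctional fun D (_ : ℕ) => active D :=
  comp₁ (f := fun n : ℕ => n.unpair.1) (Computable.fst.comp Computable.unpair)
    (digit (param (Computable.const 0)))

theorem activeState_computable : ComputableFunctional activeState :=
  digit (comp₂ (f := fun a k : ℕ => Nat.pair a k + 1)
    (Primrec.succ.comp (Primrec₂.natPair.comp Primrec.fst Primrec.snd)).to_comp
    active_computable (param Computable.id))

theorem halted_computable (z : Bool) : ComputableFunctional fun D (_ : ℕ) => halted z D :=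
  comp₁ (f := fun n : ℕ => z && decide (n = 0))
    (Primrec.and.comp (Primrec.const z)
      (PrimrecPred.decide (Primrec.eq.comp Primrec.id (Primrec.const 0)))).to_comp
    (activeState_computable.comp_param (Computable.const 0))

theorem activeProgram_computable (z : Bool) : ComputableFunctional (activeProgram z) :=
  cond (halted_computable z) (const zeroProgram_computable) (fstB'.comp_left activeState_computable)

theorem activeInstance_computable (z : Bool) {d : Baire} (hd : Computable d) :
    ComputableFunctional (activeInstance z d) :=
  cond (halted_computable z) (const hd) (sndB'.comp_left activeState_computable)

theorem advance_computable (z : Bool) : ComputableFunctional (advance z) := by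
  have hpred : Computable fun k : ℕ => (k - 1).unpair :=
    Computable.unpair.comp Computable.pred
  have h1 : ComputableFunctional fun (t : Baire) (k : ℕ) =>
      decide ((k - 1).unpair.1 = active (fstB t)) :=
    comp₂ (f := fun a b : ℕ => decide (a = b))
      (PrimrecPred.decide (Primrec.eq.comp Primrec.fst Primrec.snd)).to_comp
      (param (Computable.fst.comp hpred)) (active_computable.comp_left fstB')
  have h2 : ComputableFunctional fun (t : Baire) (k : ℕ) =>
      decide ((k - 1).unpair.1 = active (fstB t)) && !halted z (fstB t) :=
    comp₂ (f := fun a b : Bool => a && !b)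
      (Primrec.and.comp Primrec.fst (Primrec.not.comp Primrec.snd)).to_comp h1
      ((halted_computable z).comp_left fstB')
  exact cond (param (PrimrecPred.decide (Primrec.eq.comp Primrec.id (Primrec.const 0))).to_comp)
    (comp₁ (f := Nat.succ) Computable.succ (fstB'.comp_param (Computable.const 0)))
    (cond h2 (sndB'.comp_param (Computable.snd.comp hpred)) fstB')

theorem cons_computable (n : ℕ) : ComputableFunctional (cons n) := by
  have h := cond (param (PrimrecPred.decide (Primrec.eq.comp Primrec.id (Primrec.const 0))).to_comp)
    (param (Computable.const n)) (reindex Computable.pred)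
  convert h using 3 with c k
  cases k <;> rfl

end

theorem activeState_cons (n : ℕ) (c : Baire) : activeState (cons n c) = proj n.unpair.1 c := rfl

theorem advance_of_halted {z : Bool} {n : ℕ} {c u : Baire} (h : halted z (cons n c) = true) :
    advance z (pair (cons n c) u) = cons (n + 1) c := by
  funext k
  cases k <;> simp [advance, fstB_pair, h, cons]

theorem exists_advance_eq {z : Bool} {n : ℕ} {c u : Baire} (h : halted z (cons n c) = false) :
    ∃ c', advance z (pair (cons n c) u) = cons (n + 1) c' ∧ proj n.unpair.1 c' = u ∧
      ∀ j, j ≠ n.unpair.1 → proj j c' = proj j c := by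
  refine ⟨fun k => advance z (pair (cons n c) u) (k + 1), ?_, ?_, fun j hj => ?_⟩
  · funext k
    cases k <;> simp [advance, fstB_pair, cons]
  · funext k
    simp [advance, fstB_pair, sndB_pair, h, proj, active, cons]
  · funext k
    simp [advance, fstB_pair, sndB_pair, proj, active, cons, hj]

/-- A state `E (cons n c)` of the loop simulates one step of the run number `n.unpair.1` in the
family of runs with the current states `proj j c`. -/
theorem step_simulation {z : Bool} {d : Baire} {E : Baire → Baire}
    (hE : ∀ D, sndB (E D) = activeInstance z d D)
    (hE' : ∀ D r u, u ∈ Phi (activeProgram z D) r → E (advance z (pair D u)) ∈ Phi (fstB (E D)) r)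
    {f : MultiMap Baire Baire} (hd : z = true → d ∈ mdom f) {n : ℕ} {c : Baire}
    (hc : proj n.unpair.1 c ∈ mdom (haltStep z f)) :
    E (cons n c) ∈ mdom (step f) ∧ ∀ Q ∈ step f (E (cons n c)), ∃ c', Q = E (cons (n + 1) c') ∧
      proj n.unpair.1 c' ∈ haltStep z f (proj n.unpair.1 c) ∧
        ∀ j, j ≠ n.unpair.1 → proj j c' = proj j c := by
  -- All answers have to be covered, since a state lies in the domain of `step f` only if its
  -- program converges on every one of them.
  have key : (f (activeInstance z d (cons n c))).Nonempty ∧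
      ∀ r ∈ f (activeInstance z d (cons n c)), ∃ c',
        E (cons (n + 1) c') ∈ Phi (fstB (E (cons n c))) r ∧
        proj n.unpair.1 c' ∈ haltStep z f (proj n.unpair.1 c) ∧
        ∀ j, j ≠ n.unpair.1 → proj j c' = proj j c := by
    cases hh : halted z (cons n c) with
    | true =>
      have hz : z = true ∧ proj n.unpair.1 c 0 = 0 := by
        rw [halted, activeState_cons, Bool.and_eq_true] at hh
        exact ⟨hh.1, of_decide_eq_true hh.2⟩
      have h1 : activeInstance z d (cons n c) = d := by funext k; simp [activeInstance, hh]
      have h2 : activeProgram z (cons n c) = zeroProgram := by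
        funext k; simp [activeProgram, hh]
      rw [h1]
      refine ⟨hd hz.1, fun r _ => ⟨c, ?_, ?_, fun _ _ => rfl⟩⟩
      · have := hE' (cons n c) r _ (h2 ▸ mem_phi_zeroProgram r)
        rwa [advance_of_halted hh] at this
      · rw [haltStep, if_pos hz]
        exact rfl
    | false =>
      have hz : ¬ (z = true ∧ proj n.unpair.1 c 0 = 0) := by
        have := hh
        simp only [halted, activeState_cons] at this
        rintro ⟨h1, h2⟩
        simp [h1, h2] at this
      have h1 : activeInstance z d (cons n c) = sndB (proj n.unpair.1 c) := by
        funext k; simp [activeInstance, hh, activeState_cons]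
      have h2 : activeProgram z (cons n c) = fstB (proj n.unpair.1 c) := by
        funext k; simp [activeProgram, hh, activeState_cons]
      rw [haltStep, if_neg hz]
      obtain ⟨s, hs⟩ := hc
      rw [haltStep, if_neg hz] at hs
      obtain ⟨hdom, r₀, hr₀, -⟩ := mem_step.1 hs
      rw [h1]
      refine ⟨⟨r₀, hr₀⟩, fun r hr => ?_⟩
      obtain ⟨u, hu⟩ := hdom r hr
      obtain ⟨c', hc', hi, hj⟩ := exists_advance_eq (u := u) hh
      refine ⟨c', ?_, hi ▸ mem_step.2 ⟨hdom, r, hr, hu⟩, hj⟩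
      rw [← hc']
      exact hE' _ _ _ (h2 ▸ hu)
  rw [← hE] at key
  obtain ⟨⟨r₀, hr₀⟩, key⟩ := key
  refine ⟨?_, fun Q hQ => ?_⟩
  · obtain ⟨c', hc', -⟩ := key r₀ hr₀
    exact ⟨_, mem_step.2 ⟨fun r hr => ⟨_, (key r hr).choose_spec.1⟩, r₀, hr₀, hc'⟩⟩
  · obtain ⟨-, r, hr, hQr⟩ := mem_step.1 hQ
    obtain ⟨c', hc', h⟩ := key r hr
    -- The universal function is single-valued, so `Q` is the state already found for the answer
    -- `r`.
    exact ⟨c', Part.mem_unique hQr hc', h⟩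

/-- The state number `k` of the simulated run number `j`, read off from a run of the simulation. -/
def simulated (s : Baire) (j k : ℕ) : Baire := fun l =>
  unidle (proj (Nat.pair j k) s (4 * (Nat.pair j l + 1)))

/-- The sets `S j` are invariants: as long as the current state of each run `j` stays in `S j`, no
pass of the big loop can fail. `K` starts the counter at `0` and does not depend on `f`. -/
theorem exists_simulation (z : Bool) {d : Baire} (hd : Computable d) :
    ∃ K : Baire → Baire, ComputableFunctional K ∧ ∀ f : MultiMap Baire Baire,
      (z = true → d ∈ mdom f) → ∀ (p : Baire) (S : ℕ → Set Baire), (∀ j, proj j p ∈ S j) →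
      (∀ j, ∀ q ∈ S j, q ∈ mdom (haltStep z f) ∧ haltStep z f q ⊆ S j) →
      K p ∈ mdom (invLim f) ∧ ∀ s ∈ invLim f (K p), ∀ j, simulated s j 0 = proj j p ∧
        ∀ k, simulated s j (k + 1) ∈ haltStep z f (simulated s j k) := by
  obtain ⟨E, hEc, hE, hread, hE'⟩ := exists_loop (activeProgram_computable z)
    (activeInstance_computable z hd) (advance_computable z)
  refine ⟨fun p => E (cons 0 p), hEc.comp_left (cons_computable 0), fun f hf p S hp hS => ?_⟩
  have hstep : ∀ n c, (∀ j, proj j c ∈ S j) → E (cons n c) ∈ mdom (step f) ∧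
      ∀ Q ∈ step f (E (cons n c)), ∃ c', Q = E (cons (n + 1) c') ∧ (∀ j, proj j c' ∈ S j) ∧
        proj n.unpair.1 c' ∈ haltStep z f (proj n.unpair.1 c) ∧
          ∀ j, j ≠ n.unpair.1 → proj j c' = proj j c := by
    intro n c hc
    obtain ⟨h1, h2⟩ := step_simulation hE hE' hf (hS _ _ (hc n.unpair.1)).1
    refine ⟨h1, fun Q hQ => ?_⟩
    obtain ⟨c', rfl, hi, hj⟩ := h2 Q hQ
    refine ⟨c', rfl, fun j => ?_, hi, hj⟩
    by_cases h : j = n.unpair.1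
    · subst h; exact (hS _ _ (hc _)).2 hi
    · rw [hj j h]; exact hc j
  refine ⟨?_, ?_⟩
  · rw [mdom_invLim]
    have hreach : ∀ n, ∀ Q ∈ reach f (E (cons 0 p)) n, ∃ c, Q = E (cons n c) ∧
        ∀ j, proj j c ∈ S j := by
      intro n
      induction n with
      | zero => rintro Q rfl; exact ⟨p, rfl, hp⟩
      | succ n ih =>
        rintro Q ⟨R, hR, hQ⟩
        obtain ⟨c, rfl, hc⟩ := ih R hR
        obtain ⟨c', rfl, hc', -⟩ := (hstep n c hc).2 Q hQ
        exact ⟨c', rfl, hc'⟩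
    intro n Q hQ
    obtain ⟨c, rfl, hc⟩ := hreach n Q hQ
    exact (hstep n c hc).1
  · rintro s ⟨-, Q, hQ0, hQ, rfl⟩
    have hc : ∃ c : ℕ → Baire, c 0 = p ∧ ∀ n, Q n = E (cons n (c n)) ∧
        (proj n.unpair.1 (c (n + 1)) ∈ haltStep z f (proj n.unpair.1 (c n)) ∧
          ∀ j, j ≠ n.unpair.1 → proj j (c (n + 1)) = proj j (c n)) := by
      -- Reading the data from the states fixes one sequence `c`, so that the existential statements
      -- about consecutive passes fit together. The shift `k + 1` skips the counter.
      set c : ℕ → Baire := fun n k => unidle (Q n (4 * (k + 1))) with hcdef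
      have hc : ∀ n c', Q n = E (cons n c') → c n = c' := by
        intro n c' h
        funext k
        rw [hcdef]
        simp only [h, hread]
        rfl
      have hQc : ∀ n, Q n = E (cons n (c n)) ∧ ∀ j, proj j (c n) ∈ S j := by
        intro n
        induction n with
        | zero => rw [hc 0 p hQ0]; exact ⟨hQ0, hp⟩
        | succ n ih =>
          obtain ⟨c', hc', hS', -⟩ := (hstep n _ ih.2).2 _ (ih.1 ▸ hQ n)
          rw [hc _ _ hc']
          exact ⟨hc', hS'⟩
      refine ⟨c, hc 0 p hQ0, fun n => ⟨(hQc n).1, ?_⟩⟩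
      obtain ⟨c', hc', -, h⟩ := (hstep n _ (hQc n).2).2 _ ((hQc n).1 ▸ hQ n)
      rwa [hc _ _ hc']
    obtain ⟨c, hc0, hc⟩ := hc
    have hsim : ∀ j k, simulated (tuple Q) j k = proj j (c (Nat.pair j k)) := by
      intro j k
      funext l
      rw [simulated, proj_tuple, (hc _).1, hread]
      rfl
    -- Between its turns, a run keeps its state.
    have hconst : ∀ j a b, a ≤ b → (∀ n, a ≤ n → n < b → j ≠ n.unpair.1) →
        proj j (c b) = proj j (c a) := by
      intro j a b hab
      induction b, hab using Nat.le_induction with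
      | base => intro _; rfl
      | succ b hab ih =>
        intro h
        rw [(hc b).2.2 j (h b hab (Nat.lt_succ_self b)), ih fun n h1 h2 => h n h1 (by omega)]
    have hmono : ∀ j, StrictMono (Nat.pair j) := fun j _ _ h => Nat.pair_lt_pair_right j h
    intro j
    refine ⟨?_, fun k => ?_⟩
    -- The first turn of run `j` is at time `Nat.pair j 0`, so until then its state is the initial
    -- one.
    · rw [hsim, hconst j 0 _ (Nat.zero_le _), hc0]
      rintro n - hn rfl
      have h0 := (hmono n.unpair.1).monotone (Nat.zero_le n.unpair.2)
      rw [Nat.pair_unpair] at h0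
      omega
    -- The pass at time `Nat.pair j k` makes the step, and run `j` has no further turn before time
    -- `Nat.pair j (k + 1)`.
    · rw [hsim, hsim, hconst j (Nat.pair j k + 1) _ (hmono j (Nat.lt_succ_self k))]
      · simpa using (hc (Nat.pair j k)).2.1
      · rintro n h1 h2 rfl
        rw [← Nat.pair_unpair n] at h1 h2
        simp only [Nat.unpair_pair] at h1 h2
        have h3 := (hmono _).lt_iff_lt.1 h1
        have h4 := (hmono _).lt_iff_lt.1 h2
        omega

/-! ### Reductions between problems on Baire space -/

theorem realizes_onBaire {F : Baire →. Baire} {f : MultiMap Baire Baire} :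
    Realizes F (Problem.onBaire f) ↔ ∀ p ∈ mdom f, ∃ r ∈ F p, r ∈ f p := by
  constructor
  · intro h p hp
    obtain ⟨r, hr, y, hy, hf⟩ := h p p (Part.mem_some p) hp
    obtain rfl := Part.mem_some_iff.1 hy
    exact ⟨y, hr, hf⟩
  · intro h p x hx hd
    obtain rfl := Part.mem_some_iff.1 hx
    obtain ⟨r, hr, hf⟩ := h x hd
    exact ⟨r, hr, r, Part.mem_some r, hf⟩

theorem realizes_parallelization_onBaire {F : Baire →. Baire} {f : MultiMap Baire Baire} :
    Realizes F (Problem.onBaire f).parallelization ↔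
      ∀ p, (∀ i, proj i p ∈ mdom f) → ∃ r ∈ F p, ∀ i, proj i r ∈ f (proj i p) := by
  have hname : ∀ p, (fun i => proj i p) ∈ Representation.baire.seq.map p :=
    fun p => ⟨fun _ => trivial, rfl⟩
  constructor
  · intro h p hp
    obtain ⟨r, hr, y, hy, hf⟩ := h p _ (hname p)
      ⟨fun i => (hp i).choose, fun i => (hp i).choose_spec⟩
    obtain rfl := Part.mem_unique hy (hname r)
    exact ⟨r, hr, hf⟩
  · intro h p x hx hd
    obtain rfl := Part.mem_unique hx (hname p)
    obtain ⟨y, hy⟩ := hd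
    obtain ⟨r, hr, hf⟩ := h p fun i => ⟨y i, hy i⟩
    exact ⟨r, hr, _, hname r, hf⟩

theorem SWReducible.trans {X Y Z W U V : Type*} {f : Problem X Y} {g : Problem Z W}
    {h : Problem U V} (hfg : SWReducible f g) (hgh : SWReducible g h) : SWReducible f h := by
  obtain ⟨H, K, hH, hK, hf⟩ := hfg
  obtain ⟨H', K', hH', hK', hg⟩ := hgh
  refine ⟨_, _, hH.comp hH', hK'.comp hK, fun G hG => ?_⟩
  have h : (fun p => (((K p).bind K').bind G).bind fun q => (H' q).bind H : Baire →. Baire) =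
      fun p => ((K p).bind fun q => ((K' q).bind G).bind H').bind H := by
    funext p
    refine ((Part.bind_assoc _ _ _).trans (Part.bind_assoc _ _ _)).trans
      (Eq.trans ?_ (Part.bind_assoc _ _ _).symm)
    refine congrArg (Part.bind (K p)) (funext fun q => ?_)
    exact ((Part.bind_assoc _ _ _).trans (Part.bind_assoc _ _ _)).symm
  rw [h]
  exact hf _ (hg G hG)

theorem mem_bind_total {K : Baire → Baire} {G H : Baire →. Baire} {p s r : Baire}
    (hs : s ∈ G (K p)) (hr : r ∈ H s) : r ∈ ((total K p).bind G).bind H :=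
  Part.mem_bind (Part.mem_bind (Part.mem_some _) hs) hr

/-- The instance is repeated in all components and component `0` of the answer is used. -/
theorem swReducible_parallelization (f : MultiMap Baire Baire) :
    SWReducible (Problem.onBaire f) (Problem.onBaire f).parallelization := by
  have hK : ComputableFunctional fun p : Baire => tuple fun _ => p :=
    ComputableFunctional.reindex (Computable.snd.comp Computable.unpair)
  have hH : ComputableFunctional (proj 0) :=
    ComputableFunctional.reindex (Primrec₂.natPair.comp (Primrec.const 0) Primrec.id).to_comp
  refine ⟨_, _, hH.isComputable, hK.isComputable, fun G hG => ?_⟩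
  rw [realizes_parallelization_onBaire] at hG
  refine realizes_onBaire.2 fun p hp => ?_
  obtain ⟨r, hr, h⟩ := hG (tuple fun _ => p) fun i => by rwa [proj_tuple]
  exact ⟨proj 0 r, mem_bind_total hr (Part.mem_some _), by simpa only [proj_tuple] using h 0⟩

theorem simulated_computable : ComputableFunctional fun s (a : ℕ × ℕ × ℕ) =>
    simulated s a.1 a.2.1 a.2.2 := by
  open Primrec in
  have h : Primrec fun a : ℕ × ℕ × ℕ =>
      Nat.pair (Nat.pair a.1 a.2.1) (4 * (Nat.pair a.1 a.2.2 + 1)) :=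
    Primrec₂.natPair.comp (Primrec₂.natPair.comp fst (fst.comp snd))
      (nat_mul.comp (const 4) (succ.comp (Primrec₂.natPair.comp fst (snd.comp snd))))
  exact (ComputableFunctional.digit (.param h.to_comp)).comp₁ unidle_primrec.to_comp

theorem inverseLimit_parallelization_le (f : MultiMap Baire Baire) :
    SWReducible (Problem.onBaire (invLim f)).parallelization (Problem.onBaire (invLim f)) := by
  obtain ⟨K, hK, hsim⟩ := exists_simulation false (Computable.const 0 : Computable fun _ : ℕ => 0)
  have hH : ComputableFunctional fun s => tuple fun j => tuple (simulated s j) :=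
    simulated_computable.comp_param (f := fun n : ℕ => (n.unpair.1, n.unpair.2.unpair))
      (Computable.pair (Computable.fst.comp Computable.unpair)
        (Computable.unpair.comp (Computable.snd.comp Computable.unpair)))
  refine ⟨_, _, hH.isComputable, hK.isComputable, fun G hG => ?_⟩
  rw [realizes_onBaire] at hG
  refine realizes_parallelization_onBaire.2 fun p hp => ?_
  simp only [mdom_invLim] at hp
  -- The invariant is reachability from `proj j p`; membership in the domain of the inverse limit
  -- says precisely that reachable states have successors.
  obtain ⟨hdom, hrun⟩ := hsim f (by simp) p (fun j => {q | ∃ i, q ∈ reach f (proj j p) i})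
    (fun j => ⟨0, rfl⟩) (fun j q ⟨i, hi⟩ => by
      have hq : haltStep false f q = step f q := if_neg (by simp)
      refine ⟨?_, fun r hr => ⟨i + 1, q, hi, hq ▸ hr⟩⟩
      obtain ⟨r, hr⟩ := hp j i hi
      exact ⟨r, hq ▸ hr⟩)
  obtain ⟨s, hs, hlim⟩ := hG _ hdom
  refine ⟨_, mem_bind_total hs (Part.mem_some _), fun j => ?_⟩
  obtain ⟨h0, hstep⟩ := hrun s hlim j
  rw [proj_tuple]
  exact ⟨hp j, simulated s j, h0, fun k => by simpa [haltStep] using hstep k, rfl⟩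

/-! ### Frozen runs and the diamond -/

/-- The partial function computed by a search. -/
noncomputable def searchFun (g : Baire → ℕ × ℕ → Option ℕ) : Baire →. Baire := fun p =>
  ⟨∃ r, SearchSpec g p r, fun h => h.choose⟩

theorem searchSpec_unique {g : Baire → ℕ × ℕ → Option ℕ} {p r s : Baire} (hr : SearchSpec g p r)
    (hs : SearchSpec g p s) : r = s := by
  funext n
  obtain ⟨i, hi⟩ := (hr n).1
  exact (hs n).2 i _ hi

theorem mem_searchFun {g : Baire → ℕ × ℕ → Option ℕ} {p r : Baire} :
    r ∈ searchFun g p ↔ SearchSpec g p r := by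
  constructor
  · rintro ⟨h, rfl⟩
    exact h.choose_spec
  · intro h
    have hd : ∃ r, SearchSpec g p r := ⟨r, h⟩
    exact ⟨hd, searchSpec_unique hd.choose_spec h⟩

theorem isComputable_searchFun {g : Baire → ℕ × ℕ → Option ℕ} (hg : ComputableFunctional g) :
    IsComputable (searchFun g) :=
  IsComputable.of_search hg fun _ _ => mem_searchFun.1

/-- The states that a run of the loop that is kept at `0` can reach from `p`. -/
def haltReach (f : MultiMap Baire Baire) (p : Baire) : Set Baire :=
  {q | q 0 = 0 ∨ ∃ k c, c 0 = p ∧ IsFiniteRun f k c ∧ (∀ i ≤ k, c i 0 ≠ 0) ∧ c k = q}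

theorem self_mem_haltReach (f : MultiMap Baire Baire) (p : Baire) : p ∈ haltReach f p := by
  by_cases h : p 0 = 0
  · exact Or.inl h
  · exact Or.inr ⟨0, fun _ => p, rfl, fun i hi => absurd hi (Nat.not_lt_zero i), fun _ _ => h, rfl⟩

/-- States beginning with `0` are fixed by `haltStep true f`, so all of them may be admitted. Any
other state in the set ends a finite run that avoids `0`, and it has a successor because such a run
must not stall. -/
theorem haltStep_haltReach {f : MultiMap Baire Baire} {p : Baire} (hp : p ∈ diamondDom f)
    {q : Baire} (hq : q ∈ haltReach f p) :
    q ∈ mdom (haltStep true f) ∧ haltStep true f q ⊆ haltReach f p := by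
  by_cases h0 : q 0 = 0
  · have h : haltStep true f q = {q} := if_pos ⟨rfl, h0⟩
    refine ⟨⟨q, h ▸ rfl⟩, ?_⟩
    rw [h]
    rintro r rfl
    exact hq
  · have h : haltStep true f q = step f q := if_neg fun h => h0 h.2
    obtain ⟨k, c, hc0, hrun, hne, rfl⟩ := hq.resolve_left h0
    constructor
    · by_contra hstall
      exact hp.1 ⟨k, c, hc0, hrun, fun ⟨r, hr⟩ => hstall ⟨r, h ▸ hr⟩, hne⟩
    · rw [h]
      intro r hr
      by_cases hr0 : r 0 = 0
      · exact Or.inl hr0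
      · refine Or.inr ⟨k + 1, fun i => if i ≤ k then c i else r, by simp [hc0], fun i hi => ?_,
          fun i hi => ?_, by simp⟩
        · by_cases hik : i = k
          · subst hik; simpa using hr
          · have h1 : i + 1 ≤ k := by omega
            have h2 : i ≤ k := by omega
            simpa [h1, h2] using hrun i h1
        · by_cases hik : i ≤ k
          · simpa [hik] using hne i hik
          · simpa [hik] using hr0

/-- The run must reach a state beginning with `0`, as it would otherwise be infinite and
unsuccessful. From the first such state on it is constant, so a search may stop at any of them. -/
theorem exists_halt_state {f : MultiMap Baire Baire} {p : Baire} (hp : p ∈ diamondDom f)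
    {u : ℕ → Baire} (h0 : u 0 = p) (hu : ∀ k, u (k + 1) ∈ haltStep true f (u k)) :
    ∃ r ∈ diamondMap f p, (∃ k, u k 0 = 0) ∧ ∀ k, u k 0 = 0 → u k = r := by
  classical
  have hstep : ∀ k, u k 0 ≠ 0 → u (k + 1) ∈ step f (u k) := fun k hk => by
    simpa [haltStep, hk] using hu k
  have hex : ∃ k, u k 0 = 0 := by
    by_contra hne
    exact hp.2 ⟨u, h0, fun k => hstep k fun h => hne ⟨k, h⟩, fun k h => hne ⟨k, h⟩⟩
  have hmin : ∀ i < Nat.find hex, u i 0 ≠ 0 := fun i => Nat.find_min hex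
  refine ⟨u (Nat.find hex), ⟨hp, Nat.find hex, u, h0, fun i hi => hstep i (hmin i hi),
    ⟨Nat.find_spec hex, hmin⟩, rfl⟩, hex, fun k hk => ?_⟩
  have hle : Nat.find hex ≤ k := Nat.find_min' hex hk
  clear hk
  induction k, hle using Nat.le_induction with
  | base => rfl
  | succ k _ ih =>
    have h1 : u k 0 = 0 := by rw [ih]; exact Nat.find_spec hex
    have h2 := hu k
    rw [haltStep, if_pos ⟨rfl, h1⟩] at h2
    rw [← ih]
    exact h2

theorem diamond_parallelization_le (f : MultiMap Baire Baire)
    (hf : ∃ d : Baire, Computable d ∧ d ∈ mdom f) :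
    SWReducible (Problem.onBaire (diamondMap f)).parallelization (Problem.onBaire (invLim f)) := by
  obtain ⟨d, hd, hdf⟩ := hf
  obtain ⟨K, hK, hsim⟩ := exists_simulation true hd
  -- The index `a.1` codes a run and a digit of its result; `a.2` is the time at which that run is
  -- inspected.
  set g : Baire → ℕ × ℕ → Option ℕ := fun s a =>
    bif decide (simulated s a.1.unpair.1 a.2 0 = 0) then
      some (simulated s a.1.unpair.1 a.2 a.1.unpair.2) else none with hgdef
  have hg : ComputableFunctional g := by
    have h1 : Computable fun a : ℕ × ℕ => (a.1.unpair.1, a.2, 0) :=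
      .pair (Computable.fst.comp (Computable.unpair.comp Computable.fst))
        (.pair Computable.snd (Computable.const 0))
    have h2 : Computable fun a : ℕ × ℕ => (a.1.unpair.1, a.2, a.1.unpair.2) :=
      .pair (Computable.fst.comp (Computable.unpair.comp Computable.fst))
        (.pair Computable.snd (Computable.snd.comp (Computable.unpair.comp Computable.fst)))
    have h3 := simulated_computable.comp_param h1
    have h4 := simulated_computable.comp_param h2
    exact .cond (.comp₁ (f := fun n : ℕ => decide (n = 0))
        (PrimrecPred.decide (Primrec.eq.comp Primrec.id (Primrec.const 0))).to_comp h3)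
      (.comp₁ Computable.option_some h4) (.param (Computable.const none))
  refine ⟨_, _, isComputable_searchFun hg, hK.isComputable, fun G hG => ?_⟩
  rw [realizes_onBaire] at hG
  refine realizes_parallelization_onBaire.2 fun p hp => ?_
  simp only [mdom_diamondMap] at hp
  obtain ⟨hdom, hrun⟩ := hsim f (fun _ => hdf) p (fun j => haltReach f (proj j p))
    (fun j => self_mem_haltReach f _) (fun j q hq => haltStep_haltReach (hp j) hq)
  obtain ⟨s, hs, hlim⟩ := hG _ hdom
  choose r hr hex heq using fun j =>
    exists_halt_state (hp j) (hrun s hlim j).1 (hrun s hlim j).2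
  have hspec : SearchSpec g s (tuple r) := by
    intro n
    constructor
    · obtain ⟨k, hk⟩ := hex n.unpair.1
      exact ⟨k, by simp [hgdef, hk, heq _ k hk, tuple]⟩
    · intro k y hy
      by_cases hk : simulated s n.unpair.1 k 0 = 0
      · simpa [hgdef, hk, heq _ k hk, tuple, eq_comm] using hy
      · simp [hgdef, hk] at hy
  exact ⟨tuple r, mem_bind_total hs (mem_searchFun.2 hspec),
    fun j => by rw [proj_tuple]; exact hr j⟩

/-! ### Pointed problems -/

theorem mem_mdom_realizerVersion {X Y : Type*} {f : Problem X Y} {p : Baire} {x : X}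
    (hx : x ∈ f.inRep.map p) (hd : x ∈ mdom f.map) : p ∈ mdom f.realizerVersion := by
  obtain ⟨y, hy⟩ := hd
  obtain ⟨r, hr⟩ := f.outRep.surj y
  refine ⟨r, fun y' _ => f.outRep.surj y', y, ⟨?_, x, hx, hy⟩, hr⟩
  intro x' hx'
  rw [Part.mem_unique hx' hx]
  exact ⟨y, hy⟩

/-- The value of a computable function at the zero sequence is computable. -/
theorem IsComputable.computable_of_mem_zero {F : Baire →. Baire} (hF : IsComputable F) {d : Baire}
    (hd : d ∈ F fun _ => 0) : Computable d := by
  obtain ⟨h, hh, hm, ha⟩ := hF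
  have hs := ha _ _ hd
  have hw : Computable fun k => h (word (fun _ => 0) k) :=
    hh.comp (Primrec.list_map Primrec.list_range (Primrec.const 0).to₂).to_comp
  have hp : Partrec fun n : ℕ => Nat.rfindOpt fun k : ℕ => (h (word (fun _ => 0) k))[n]? := by
    have h1 : Computable fun x : ℕ × ℕ => (h (word (fun _ => 0) x.2))[x.1]? :=
      Computable.list_getElem?.comp (hw.comp Computable.snd) Computable.fst
    exact Partrec.rfindOpt h1
  refine hp.of_eq_tot fun n => ?_
  have hval : ∀ k y, (h (word (fun _ => 0) k))[n]? = some y → y = d n := by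
    intro k y hy
    obtain ⟨m, hm⟩ := hs.1 _ ⟨k, rfl⟩
    rw [hm] at hy
    have hn : n < m := by
      by_contra hn
      rw [List.getElem?_eq_none (by rw [word_length]; omega)] at hy
      simp at hy
    rw [word_getElem? d hn] at hy
    exact (Option.some.inj hy).symm
  have hdom : (Nat.rfindOpt fun k => (h (word (fun _ => 0) k))[n]?).Dom := by
    rw [Nat.rfindOpt_dom]
    obtain ⟨_, ⟨k, rfl⟩, hk⟩ := hs.2 (n + 1)
    obtain ⟨m, hm⟩ := hs.1 _ ⟨k, rfl⟩
    have hle := hk.length_le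
    rw [hm, word_length, word_length] at hle
    exact ⟨k, d n, by rw [hm]; exact word_getElem? d hle⟩
  obtain ⟨k, hk⟩ := Nat.rfindOpt_spec (Part.get_mem hdom)
  rw [← hval k _ hk]
  exact Part.get_mem hdom

/-- The inner reduction function maps the zero sequence to a name of an instance, and this name is
computable. -/
theorem Problem.Pointed.exists_computable_instance {X Y : Type*} {f : Problem X Y}
    (hf : f.Pointed) : ∃ d : Baire, Computable d ∧ d ∈ mdom f.realizerVersion := by
  obtain ⟨H, K, -, hK, h⟩ := hf
  obtain ⟨F, hF⟩ := f.exists_realizer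
  -- The realizer is cut down to names of points in the domain of `f`; being defined at `K` of the
  -- zero sequence then forces that value to be such a name.
  have hG : Realizes (fun p => ⟨(F p).Dom ∧ ∃ x ∈ f.inRep.map p, x ∈ mdom f.map,
      fun hp => (F p).get hp.1⟩) f := by
    intro p x hx hd
    obtain ⟨r, ⟨hr, rfl⟩, hy⟩ := hF p x hx hd
    exact ⟨_, ⟨⟨hr, x, hx, hd⟩, rfl⟩, hy⟩
  obtain ⟨r, hr, -⟩ := realizes_onBaire.1 (h _ hG) (fun _ => 0) ⟨_, rfl⟩
  obtain ⟨t, ht, -⟩ := Part.mem_bind_iff.1 hr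
  obtain ⟨d, hd, ⟨-, x, hx, hxd⟩, -⟩ := Part.mem_bind_iff.1 ht
  exact ⟨d, hK.computable_of_mem_zero hd, mem_mdom_realizerVersion hx hxd⟩

end Weihrauch

theorem proposition14 {X : Type*} {Y : Type*} (f : Weihrauch.Problem X Y) :
    Weihrauch.SWEquiv f.inverseLimit.parallelization f.inverseLimit ∧
    (f.Pointed → Weihrauch.SWReducible f.diamond f.inverseLimit) ∧
    (f.Pointed → Weihrauch.SWReducible f.diamond.parallelization f.inverseLimit) :=
  have hdiamond := fun hf : f.Pointed =>
    Weihrauch.diamond_parallelization_le _ hf.exists_computable_instance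
  ⟨⟨Weihrauch.inverseLimit_parallelization_le _, Weihrauch.swReducible_parallelization _⟩,
    fun hf => (Weihrauch.swReducible_parallelization _).trans (hdiamond hf), hdiamond⟩
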